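/- Let $T\subseteq\mathbb{R}$ be a time interval (open, closed or half-open, bounded or not) containing the initial time $0$, let $N\in\mathbb{N}$, and let $m=m(x,t):\mathbb{R}\times T\to S^2\subset\mathbb{R}^3$ be a classical solution of the half-wave maps equation $$\partial_t m = m\times|\nabla| m ,\qquad |\nabla|=(-\Delta)^{1/2},\quad |\nabla| f(x)=\frac1{2\pi}\int_{\mathbb{R}}\frac{2f(x)-f(x+h)-f(x-h)}{h^2}\,dh ,$$ on $\mathbb{R}\times T$ (with one-sided time derivative at an endpoint of $T$ belonging to $T$). Suppose that $m$ is a rational $N$-soliton: for all $x\in\mathbb{R}$ and $t\in T$, $$m(x,t)=m_0+i\sum_{j=1}^N\frac{s_j(t)}{x-x_j(t)}-i\sum_{j=1}^N\frac{\overline{s_j(t)}}{x-\overline{x_j(t)}},$$ with $m_0\in\mathbb{R}^3$, spins $s_j:T\to\mathbb{C}^3$ and poles $x_j:T\to\mathbb{C}$ that are differentiable in time, $\operatorname{Im}x_j(t)>0$ and $x_j(t)\neq x_k(t)$ for $j\ne k$ and all $t\in T$, and $s_j(0)\neq0$ for every $j$. Let $t_0\in\mathbb{R}$, and suppose that the poles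 are separated near $t_0$: there is $c>0$ such that $|x_j(t)-x_k(t)|\ge c$ for all $j\neq k$ and all $t\in T$ sufficiently close to $t_0$ (this holds in particular if $|\operatorname{Re}x_j(t)-\operatorname{Re}x_k(t)|\ge\eta$ for some $\eta>0$, all $j\neq k$ and all $t\in T$). Then there is no finite time blow-up at $t_0$, not even along a subsequence: there are no index $i$ and sequence $(t_n)$ in $T$ with $t_n\to t_0$ and $\operatorname{Im}x_i(t_n)\to0$. -/

import Mathlib

open Filter Topology

noncomputable section

/-- The half-Laplacian `|∇| = (-Δ)^{1/2}` on the line (the Fourier multiplier `|ξ|`), acting on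
bounded twice differentiable functions through its singular integral
`|∇| f (y) = (1 / (2π)) ∫ (2 f(y) - f(y + h) - f(y - h)) / h² dh`.
The constant `1 / (2π)` is the one for which `|∇| cos(ξ ·) = |ξ| cos(ξ ·)`. -/
def halfLaplacian (f : ℝ → Fin 3 → ℝ) (y : ℝ) : Fin 3 → ℝ :=
  (2 * Real.pi)⁻¹ • ∫ h : ℝ, (h ^ 2)⁻¹ • ((2 : ℝ) • f y - f (y + h) - f (y - h))

/-- `m` is a (classical) half-wave map with values in the unit sphere of `ℝ³`, on the space-time
domain `ℝ × T`, where `T` is a time interval: `|m| = 1`, the integral which defines `|∇| m`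
converges, and `∂ₜ m = m × |∇| m` (one-sided time derivative at an endpoint which belongs
to `T`). -/
structure IsHalfWaveMap (T : Set ℝ) (m : ℝ → ℝ → Fin 3 → ℝ) : Prop where
  sphere : ∀ y, ∀ t ∈ T, m y t ⬝ᵥ m y t = 1
  integrable : ∀ y, ∀ t ∈ T, MeasureTheory.Integrable
    (fun h : ℝ => (h ^ 2)⁻¹ • ((2 : ℝ) • m y t - m (y + h) t - m (y - h) t))
  equation : ∀ y, ∀ t ∈ T, HasDerivWithinAt (fun τ => m y τ)
    (crossProduct (m y t) (halfLaplacian (fun z => m z t) y)) T t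

/-- `m` is a rational `N`-soliton on the time interval `T`, with spins `s j t ∈ ℂ³` and
poles `x j t`:
`m(y,t) = m₀ + i ∑ⱼ sⱼ(t) / (y - xⱼ(t)) - i ∑ⱼ conj sⱼ(t) / (y - conj xⱼ(t))`.
The poles are simple and lie in the open upper half-plane, spins and poles are differentiable in
time, and all `N` poles are present at the initial time `0`. -/
structure IsRationalSoliton {N : ℕ} (T : Set ℝ) (m : ℝ → ℝ → Fin 3 → ℝ) (m₀ : Fin 3 → ℝ)
    (s : Fin N → ℝ → Fin 3 → ℂ) (x : Fin N → ℝ → ℂ) : Prop where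
  form : ∀ y : ℝ, ∀ t ∈ T, ∀ a : Fin 3,
    (m y t a : ℂ) = (m₀ a : ℂ)
      + Complex.I * ∑ j, s j t a / ((y : ℂ) - x j t)
      - Complex.I * ∑ j, (starRingEnd ℂ) (s j t a) / ((y : ℂ) - (starRingEnd ℂ) (x j t))
  upper : ∀ j, ∀ t ∈ T, 0 < (x j t).im
  distinct : ∀ t ∈ T, ∀ j k, j ≠ k → x j t ≠ x k t
  spin_differentiable : ∀ j, DifferentiableOn ℝ (s j) T
  pole_differentiable : ∀ j, DifferentiableOn ℝ (x j) T
  spin_initial : ∀ j, s j 0 ≠ 0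

end

/-! The spins of a soliton obey a linear-type ODE that keeps them away from zero, while a collapsing
pole would drag its spin to zero. Both facts hold uniformly near `t₀` once the poles are separated.

The half-Laplacian of a simple pole is explicit (`halfLaplacian_of_simple_poles`), so on the real
line the sphere constraint and the evolution equation are identities between rational functions,
which extend to the complex plane (`IsRationalSoliton.complex_equations`). Their Laurent
coefficients at `x_j` give the spin equation `s_j' = 2 ∑ s_j × s_k / (x_j - x_k)²` and the
Calogero–Moser type equation `x_j'' = 4 ∑ s_j ⬝ s_k / (x_j - x_k)³`.

The forces in the second equation are antisymmetric, so `∑ x_j` is affine in time; as all imaginary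
parts are positive, each is bounded on bounded times (`IsRationalSoliton.exists_im_le`). Since `|m|
≤ 1` on the line, multiplication by a Blaschke product and the maximum principle give `‖s_j‖ ≤ P *
Im x_j`, with `P` controlled by the separation (`norm_residue_le`,
`IsRationalSoliton.norm_spin_le`). The coefficient of `s_i` in the spin equation is then bounded
near `t₀`, and Grönwall bounds `‖s_i‖` at one fixed time by a constant times `Im x_i (t_n)`, which
tends to zero. But spins never vanish (`IsRationalSoliton.spin_ne_zero`), by Grönwall from time `0`.
-/

/-! ### The half-Laplacian of a simple pole. -/

lemma integrable_inv_sq_add_sq {b : ℂ} (hb : 0 < b.re) :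
    MeasureTheory.Integrable (fun h : ℝ => ((h : ℂ) ^ 2 + b ^ 2)⁻¹) := by
  have h0 : ∀ q : ℝ, MeasureTheory.Integrable (fun h : ℝ => (b.re ^ 2 + (h + q) ^ 2)⁻¹) := by
    intro q
    have h1 := ((integrable_inv_one_add_sq.comp_div hb.ne').comp_add_right q).const_mul
      ((b.re ^ 2)⁻¹)
    refine h1.congr (Eventually.of_forall fun h => ?_)
    have : b.re ^ 2 + (h + q) ^ 2 ≠ 0 := by positivity
    have : 1 + ((h + q) / b.re) ^ 2 ≠ 0 := by positivity
    dsimp only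
    field_simp
  refine ((h0 b.im).add (h0 (-b.im))).mono' ?_ (Eventually.of_forall fun h => ?_)
  · exact Measurable.aestronglyMeasurable (by fun_prop)
  -- The two linear factors have moduli of Cauchy-kernel type, and a product of two numbers is at
  -- most the sum of their squares.
  · have e : (h : ℂ) ^ 2 + b ^ 2 = (b + Complex.I * h) * (b - Complex.I * h) := by
      linear_combination (h : ℂ) ^ 2 * Complex.I_sq
    have n1 : ‖b + Complex.I * h‖ ^ 2 = b.re ^ 2 + (h + b.im) ^ 2 := by
      rw [← Complex.normSq_eq_norm_sq, Complex.normSq_apply]; simp; ring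
    have n2 : ‖b - Complex.I * h‖ ^ 2 = b.re ^ 2 + (h + -b.im) ^ 2 := by
      rw [← Complex.normSq_eq_norm_sq, Complex.normSq_apply]; simp; ring
    simp only [Pi.add_apply]
    rw [e, norm_inv, norm_mul, ← n1, ← n2, ← inv_pow, ← inv_pow, mul_inv]
    nlinarith [sq_nonneg (‖b + Complex.I * h‖⁻¹ - ‖b - Complex.I * h‖⁻¹),
      sq_nonneg (‖b + Complex.I * h‖⁻¹), sq_nonneg (‖b - Complex.I * h‖⁻¹)]

/-- The antiderivative is the arctangent written as a difference of logarithms; for `0 < b.re` both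
arguments stay in the right half-plane, so the principal branch is smooth along the whole line. -/
lemma integral_univ_inv_sq_add_sq_complex {b : ℂ} (hb : 0 < b.re) :
    ∫ h : ℝ, ((h : ℂ) ^ 2 + b ^ 2)⁻¹ = Real.pi / b := by
  have hb0 : b ≠ 0 := fun h => by simp [h] at hb
  have m1 : ∀ h : ℝ, b + Complex.I * h ∈ Complex.slitPlane := fun h =>
    Or.inl (by simpa using hb)
  have m2 : ∀ h : ℝ, b - Complex.I * h ∈ Complex.slitPlane := fun h =>
    Or.inl (by simpa using hb)
  let F : ℝ → ℂ := fun h => (2 * Complex.I * b)⁻¹ *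
    (Complex.log (b + Complex.I * h) - Complex.log (b - Complex.I * h))
  have hF : ∀ h : ℝ, HasDerivAt F (((h : ℂ) ^ 2 + b ^ 2)⁻¹) h := by
    intro h
    have e : (h : ℂ) ^ 2 + b ^ 2 = (b + Complex.I * h) * (b - Complex.I * h) := by
      linear_combination (h : ℂ) ^ 2 * Complex.I_sq
    have d1 : HasDerivAt (fun h : ℝ => b + Complex.I * (h : ℂ)) Complex.I h := by
      simpa using (((hasDerivAt_id h).ofReal_comp).const_mul Complex.I).const_add b
    have d2 : HasDerivAt (fun h : ℝ => b - Complex.I * (h : ℂ)) (-Complex.I) h := by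
      simpa using (((hasDerivAt_id h).ofReal_comp).const_mul Complex.I).const_sub b
    have := ((d1.clog_real (m1 h)).sub (d2.clog_real (m2 h))).const_mul (2 * Complex.I * b)⁻¹
    refine this.congr_deriv ?_
    have z1 := Complex.slitPlane_ne_zero (m1 h)
    have z2 := Complex.slitPlane_ne_zero (m2 h)
    rw [e]
    field_simp
    ring
  have odd : ∀ h, F (-h) = - F h := by
    intro h
    simp only [F, Complex.ofReal_neg, mul_neg, sub_neg_eq_add, ← sub_eq_add_neg]
    ring
  have lim : Tendsto F atTop (𝓝 ((2 * Complex.I * b)⁻¹ * (Complex.I * Real.pi))) := by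
    have hz : Tendsto (fun h : ℝ => b / (h : ℂ)) atTop (𝓝 0) := by
      rw [tendsto_zero_iff_norm_tendsto_zero]
      have : Tendsto (fun h : ℝ => ‖b‖ / |h|) atTop (𝓝 0) :=
        tendsto_const_nhds.div_atTop tendsto_abs_atTop_atTop
      simpa using this
    have l1 : Tendsto (fun h : ℝ => Complex.log (b / h + Complex.I)) atTop
        (𝓝 (Complex.log Complex.I)) := by
      refine Tendsto.clog (by simpa using hz.add_const Complex.I) (Or.inr (by simp))
    have l2 : Tendsto (fun h : ℝ => Complex.log (b / h - Complex.I)) atTop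
        (𝓝 (Complex.log (-Complex.I))) := by
      refine Tendsto.clog (by simpa using hz.sub_const Complex.I) (Or.inr (by simp))
    have l3 := (l1.sub l2).const_mul (2 * Complex.I * b)⁻¹
    have e : Complex.log Complex.I - Complex.log (-Complex.I) = Complex.I * Real.pi := by
      rw [Complex.log_I, Complex.log_neg_I]; ring
    rw [e] at l3
    refine l3.congr' ?_
    filter_upwards [eventually_gt_atTop 0] with h hh
    have hc : (h : ℂ) ≠ 0 := by exact_mod_cast hh.ne'
    -- Extracting the positive factor `h` from both logarithms cancels `log h` and leaves the limit
    -- `log I - log (-I)`.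
    have e1 : b + Complex.I * h = (h : ℂ) * (b / h + Complex.I) := by field_simp
    have e2 : b - Complex.I * h = (h : ℂ) * (b / h - Complex.I) := by field_simp
    have n1 : b / h + Complex.I ≠ 0 := fun hh => by
      have := Complex.slitPlane_ne_zero (m1 h); rw [e1, hh] at this; simp at this
    have n2 : b / h - Complex.I ≠ 0 := fun hh => by
      have := Complex.slitPlane_ne_zero (m2 h); rw [e2, hh] at this; simp at this
    simp only [F]
    rw [e1, e2, Complex.log_ofReal_mul hh n1, Complex.log_ofReal_mul hh n2]
    ring
  have lim' : Tendsto F atBot (𝓝 (-((2 * Complex.I * b)⁻¹ * (Complex.I * Real.pi)))) := by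
    have := (lim.comp tendsto_neg_atBot_atTop).neg
    refine this.congr fun h => ?_
    simp [odd]
  rw [MeasureTheory.integral_of_hasDerivAt_of_tendsto hF (integrable_inv_sq_add_sq hb) lim' lim]
  field_simp
  ring

/-- The second difference quotient of the simple pole `1 / (y - a)`, integrated over all steps.
The sign `ε` tells the half-plane of the pole. -/
lemma integral_secondDifference_pole {a : ℂ} {ε : ℝ} (hε : ε ^ 2 = 1) (ha : 0 < ε * a.im)
    (y : ℝ) :
    MeasureTheory.Integrable (fun h : ℝ => ((h : ℂ) ^ 2)⁻¹ *
      (2 / ((y : ℂ) - a) - 1 / (((y + h : ℝ) : ℂ) - a) - 1 / (((y - h : ℝ) : ℂ) - a))) ∧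
    ∫ h : ℝ, ((h : ℂ) ^ 2)⁻¹ *
      (2 / ((y : ℂ) - a) - 1 / (((y + h : ℝ) : ℂ) - a) - 1 / (((y - h : ℝ) : ℂ) - a))
      = 2 * Real.pi * (-Complex.I * ε / ((y : ℂ) - a) ^ 2) := by
  have him : a.im ≠ 0 := fun h => by simp [h] at ha
  have nz : ∀ r : ℝ, (r : ℂ) - a ≠ 0 := fun r h => him (by
    have := congrArg Complex.im h; simpa using this)
  -- The rotation by `ε I` puts `b` in the right half-plane, and `b² = -(y - a)²` turns `h² + b²`
  -- into `-(y + h - a)(y - h - a)`.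
  set b : ℂ := ε * Complex.I * (y - a) with hbdef
  have hb : 0 < b.re := by simpa [hbdef] using ha
  have hεc : (ε : ℂ) ^ 2 = 1 := by exact_mod_cast hε
  have hε0 : (ε : ℂ) ≠ 0 := fun h => by simp [h] at hεc
  have key : (fun h : ℝ => (2 / ((y : ℂ) - a)) * ((h : ℂ) ^ 2 + b ^ 2)⁻¹)
      =ᵐ[MeasureTheory.volume] (fun h : ℝ => ((h : ℂ) ^ 2)⁻¹ *
      (2 / ((y : ℂ) - a) - 1 / (((y + h : ℝ) : ℂ) - a) - 1 / (((y - h : ℝ) : ℂ) - a))) := by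
    filter_upwards [MeasureTheory.Measure.ae_ne MeasureTheory.volume (0 : ℝ)] with h hh
    have hc : (h : ℂ) ≠ 0 := by exact_mod_cast hh
    have z0 := nz y
    have z1 := nz (y + h)
    have z2 := nz (y - h)
    have eb : (h : ℂ) ^ 2 + b ^ 2 = - ((((y + h : ℝ) : ℂ) - a) * (((y - h : ℝ) : ℂ) - a)) := by
      have : b ^ 2 = - ((y : ℂ) - a) ^ 2 := by
        rw [hbdef, mul_pow, mul_pow, hεc, Complex.I_sq]; ring
      rw [this]; push_cast; ring
    rw [eb]
    field_simp
    push_cast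
    ring
  refine ⟨((integrable_inv_sq_add_sq hb).const_mul _).congr key, ?_⟩
  rw [← MeasureTheory.integral_congr_ae key, MeasureTheory.integral_const_mul,
    integral_univ_inv_sq_add_sq_complex hb, hbdef]
  have z0 := nz y
  field_simp
  rw [Complex.I_sq, hεc]; ring

/-- The half-Laplacian of a rational function with simple poles off the real line. -/
lemma halfLaplacian_of_simple_poles {ι : Type*} [Fintype ι] {f : ℝ → Fin 3 → ℝ}
    {m₀ : Fin 3 → ℝ} {a : ι → ℂ} {d : ι → Fin 3 → ℂ} {ε : ι → ℝ} (hε : ∀ k, ε k ^ 2 = 1)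
    (ha : ∀ k, 0 < ε k * (a k).im)
    (hf : ∀ (y : ℝ) b, (f y b : ℂ) = m₀ b + Complex.I * ∑ k, ε k * d k b / ((y : ℂ) - a k))
    (y : ℝ)
    (hint : MeasureTheory.Integrable
      (fun h : ℝ => (h ^ 2)⁻¹ • ((2 : ℝ) • f y - f (y + h) - f (y - h)))) (b : Fin 3) :
    (halfLaplacian f y b : ℂ) = ∑ k, d k b / ((y : ℂ) - a k) ^ 2 := by
  have e1 : halfLaplacian f y b
      = (2 * Real.pi)⁻¹ * ∫ h : ℝ, (h ^ 2)⁻¹ * (2 * f y b - f (y + h) b - f (y - h) b) := by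
    have := (ContinuousLinearMap.proj (R := ℝ) (φ := fun _ : Fin 3 => ℝ) b).integral_comp_comm hint
    simp only [halfLaplacian, Pi.smul_apply, smul_eq_mul]
    congr 1
    simpa using this.symm
  have hpi : (Real.pi : ℂ) ≠ 0 := by exact_mod_cast Real.pi_ne_zero
  rw [e1, Complex.ofReal_mul, ← integral_complex_ofReal]
  have e2 : ∀ h : ℝ, (((h ^ 2)⁻¹ * (2 * f y b - f (y + h) b - f (y - h) b) : ℝ) : ℂ)
      = ∑ k, (Complex.I * ε k * d k b) * (((h : ℂ) ^ 2)⁻¹ *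
      (2 / ((y : ℂ) - a k) - 1 / (((y + h : ℝ) : ℂ) - a k) - 1 / (((y - h : ℝ) : ℂ) - a k))) := by
    intro h
    rw [Complex.ofReal_mul, Complex.ofReal_sub, Complex.ofReal_sub, Complex.ofReal_mul, hf, hf, hf]
    push_cast
    simp only [Finset.mul_sum]
    have : ∀ A B C D : ℂ, 2 * (D + A) - (D + B) - (D + C) = 2 * A - B - C := by intros; ring
    rw [this, Finset.mul_sum, ← Finset.sum_sub_distrib, ← Finset.sum_sub_distrib, Finset.mul_sum]
    refine Finset.sum_congr rfl fun k _ => ?_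
    ring
  simp only [e2]
  rw [MeasureTheory.integral_finsetSum _ fun k _ =>
    (integral_secondDifference_pole (hε k) (ha k) y).1.const_mul _]
  simp only [MeasureTheory.integral_const_mul, (integral_secondDifference_pole (hε _) (ha _) y).2]
  rw [Finset.mul_sum]
  refine Finset.sum_congr rfl fun k _ => ?_
  have hεc : (ε k : ℂ) ^ 2 = 1 := by exact_mod_cast hε k
  push_cast
  field_simp
  linear_combination (-(d k b) / ((y : ℂ) - a k) ^ 2 * (ε k : ℂ) ^ 2) * Complex.I_sq
    + (d k b) / ((y : ℂ) - a k) ^ 2 * hεc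

/-! ### Identity theorem and extraction of Taylor coefficients. -/

/-- The complement of a finite set in the plane is connected, and the real line accumulates at `0`
inside it. -/
lemma eq_zero_of_eq_zero_on_real {P : Set ℂ} (hP : P.Finite) (him : ∀ p ∈ P, p.im ≠ 0)
    {F : ℂ → ℂ} (hF : DifferentiableOn ℂ F Pᶜ) (h0 : ∀ y : ℝ, F y = 0) {z : ℂ} (hz : z ∉ P) :
    F z = 0 := by
  have hreal : ∀ y : ℝ, (y : ℂ) ∈ Pᶜ := fun y hy => him _ hy (by simp)
  have hconn : IsPreconnected Pᶜ :=
    (hP.countable.isPathConnected_compl_of_one_lt_rank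
      (by rw [Complex.rank_real_complex]; norm_num)).isConnected.isPreconnected
  have han : AnalyticOnNhd ℂ F Pᶜ := hF.analyticOnNhd hP.isClosed.isOpen_compl
  refine han.eqOn_zero_of_preconnected_of_frequently_eq_zero hconn (hreal 0) ?_ hz
  have ht : Tendsto (fun y : ℝ => (y : ℂ)) (𝓝[≠] 0) (𝓝[≠] ((0 : ℝ) : ℂ)) := by
    refine tendsto_nhdsWithin_iff.2 ⟨(Complex.continuous_ofReal.tendsto 0).mono_left
      nhdsWithin_le_nhds, ?_⟩
    filter_upwards [self_mem_nhdsWithin] with y hy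
    simpa using hy
  exact ht.frequently (Eventually.frequently (Eventually.of_forall h0))

/-- Peels off one Taylor coefficient using only continuity of the remainder, so expansions can be
compared without power series. -/
lemma eq_zero_of_add_mul_eq_zero {c : ℂ} {h : ℂ → ℂ} (hh : ContinuousAt h 0)
    (H : ∀ᶠ w in 𝓝[≠] (0 : ℂ), c + w * h w = 0) :
    c = 0 ∧ ∀ᶠ w in 𝓝[≠] (0 : ℂ), h w = 0 := by
  have hc : c = 0 := by
    have h1 : Tendsto (fun w => c + w * h w) (𝓝[≠] (0 : ℂ)) (𝓝 (c + 0 * h 0)) :=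
      (((continuousAt_id (x := (0 : ℂ))).mul hh).const_add c).tendsto.mono_left nhdsWithin_le_nhds
    have h2 : Tendsto (fun w => c + w * h w) (𝓝[≠] (0 : ℂ)) (𝓝 0) :=
      tendsto_const_nhds.congr' (by filter_upwards [H] with w hw using hw.symm)
    simpa using tendsto_nhds_unique h1 h2
  refine ⟨hc, ?_⟩
  filter_upwards [H, self_mem_nhdsWithin] with w hw hw0
  rw [hc, zero_add] at hw
  exact (mul_eq_zero.1 hw).resolve_left hw0

lemma eq_zero_of_eventually_eq_zero {h : ℂ → ℂ} (hh : ContinuousAt h 0)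
    (H : ∀ᶠ w in 𝓝[≠] (0 : ℂ), h w = 0) : h 0 = 0 :=
  tendsto_nhds_unique (hh.tendsto.mono_left nhdsWithin_le_nhds)
    (tendsto_const_nhds.congr' (by filter_upwards [H] with w hw using hw.symm))

lemma taylor_coefficients_eq_zero {c₀ c₁ : ℂ} {h : ℂ → ℂ} (hh : ContinuousAt h 0)
    (H : ∀ᶠ w in 𝓝[≠] (0 : ℂ), c₀ + w * (c₁ + w * h w) = 0) :
    c₀ = 0 ∧ c₁ = 0 ∧ h 0 = 0 := by
  obtain ⟨h0, H1⟩ := eq_zero_of_add_mul_eq_zero (by fun_prop) H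
  obtain ⟨h1, H2⟩ := eq_zero_of_add_mul_eq_zero hh H1
  exact ⟨h0, h1, eq_zero_of_eventually_eq_zero hh H2⟩

/-! ### Laurent coefficients at a pole. -/

section LaurentAlgebra
open Matrix

/-- Laurent coefficients of `M ⬝ M = 1` at a simple pole of `M`. -/
lemma laurent_sphere {s R₀ R₁ : Fin 3 → ℂ} {R₂ : ℂ → Fin 3 → ℂ}
    (hR : ∀ b, ContinuousAt (fun w => R₂ w b) 0)
    (H : ∀ᶠ w in 𝓝[≠] (0 : ℂ),
      (∑ b, (Complex.I * s b / w + (R₀ b + w * R₁ b + w ^ 2 * R₂ w b)) ^ 2) = 1) :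
    s ⬝ᵥ s = 0 ∧ R₀ ⬝ᵥ s = 0 ∧ Complex.I * (s ⬝ᵥ R₂ 0) + R₀ ⬝ᵥ R₁ = 0 := by
  have h0 := hR 0
  have h1 := hR 1
  have h2 := hR 2
  simp only [Fin.sum_univ_three] at H
  simp only [dotProduct, Fin.sum_univ_three]
  have hI := Complex.I_ne_zero
  -- The expansion of `w² (M ⬝ M - 1)`. Its orders 0, 1 and 3 give the three conclusions; order 2 is
  -- discarded.
  obtain ⟨A0, H0⟩ := eq_zero_of_add_mul_eq_zero
    (c := -(s 0 * s 0 + s 1 * s 1 + s 2 * s 2))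
    (h := fun w => 2 * Complex.I * (R₀ 0 * s 0 + R₀ 1 * s 1 + R₀ 2 * s 2) + w * (
      (2 * Complex.I * (s 0 * R₁ 0 + s 1 * R₁ 1 + s 2 * R₁ 2)
      + R₀ 0 ^ 2 + R₀ 1 ^ 2 + R₀ 2 ^ 2 - 1) + w * (
        2 * (Complex.I * (s 0 * R₂ w 0 + s 1 * R₂ w 1 + s 2 * R₂ w 2)
          + (R₀ 0 * R₁ 0 + R₀ 1 * R₁ 1 + R₀ 2 * R₁ 2))
        + w * (2 * (R₀ 0 * R₂ w 0 + R₀ 1 * R₂ w 1 + R₀ 2 * R₂ w 2)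
          + (R₁ 0 + w * R₂ w 0) ^ 2 + (R₁ 1 + w * R₂ w 1) ^ 2 + (R₁ 2 + w * R₂ w 2) ^ 2))))
    (by fun_prop) (by
      filter_upwards [H, self_mem_nhdsWithin] with w hw hw0
      have hw0 : w ≠ 0 := hw0
      field_simp at hw
      linear_combination hw - (s 0 * s 0 + s 1 * s 1 + s 2 * s 2) * Complex.I_sq)
  obtain ⟨A1, H1⟩ := eq_zero_of_add_mul_eq_zero (by fun_prop) H0
  obtain ⟨-, H2⟩ := eq_zero_of_add_mul_eq_zero (by fun_prop) H1
  have A3 := eq_zero_of_eventually_eq_zero (by fun_prop) H2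
  refine ⟨by linear_combination -A0, ?_, by linear_combination A3 / 2⟩
  exact (mul_eq_zero.1 A1).resolve_left (by simp)

/-- Laurent coefficients of `E = M × D` at a common pole. -/
lemma laurent_equation {s s' R₀ R₁ Q₀ : Fin 3 → ℂ} {v : ℂ} {R₂ Q₁ W : ℂ → Fin 3 → ℂ}
    (hR : ∀ b, ContinuousAt (fun w => R₂ w b) 0) (hQ : ∀ b, ContinuousAt (fun w => Q₁ w b) 0)
    (hW : ∀ b, ContinuousAt (fun w => W w b) 0)
    (H : ∀ᶠ w in 𝓝[≠] (0 : ℂ),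
      (fun b => Complex.I * s' b / w + Complex.I * v * s b / w ^ 2 + W w b) =
      crossProduct (fun b => Complex.I * s b / w + (R₀ b + w * R₁ b + w ^ 2 * R₂ w b))
        (fun b => s b / w ^ 2 + (Q₀ b + w * Q₁ w b))) :
    (Complex.I * v) • s = crossProduct R₀ s ∧
    Complex.I • s' = crossProduct R₁ s + Complex.I • crossProduct s Q₀ ∧
    W 0 = crossProduct (R₂ 0) s + Complex.I • crossProduct s (Q₁ 0) + crossProduct R₀ Q₀ := by
  have key : ∀ b c d : Fin 3, (∀ᶠ w in 𝓝[≠] (0 : ℂ),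
      Complex.I * s' b / w + Complex.I * v * s b / w ^ 2 + W w b =
      (Complex.I * s c / w + (R₀ c + w * R₁ c + w ^ 2 * R₂ w c)) *
        (s d / w ^ 2 + (Q₀ d + w * Q₁ w d)) -
      (Complex.I * s d / w + (R₀ d + w * R₁ d + w ^ 2 * R₂ w d)) *
        (s c / w ^ 2 + (Q₀ c + w * Q₁ w c))) →
      Complex.I * v * s b = R₀ c * s d - R₀ d * s c ∧
      Complex.I * s' b = R₁ c * s d - R₁ d * s c + Complex.I * (s c * Q₀ d - s d * Q₀ c) ∧
      W 0 b = R₂ 0 c * s d - R₂ 0 d * s c + Complex.I * (s c * Q₁ 0 d - s d * Q₁ 0 c)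
        + (R₀ c * Q₀ d - R₀ d * Q₀ c) := by
    intro b c d H
    have hRc := hR c
    have hRd := hR d
    have hQc := hQ c
    have hQd := hQ d
    have hWb := hW b
    obtain ⟨A0, A1, A2⟩ := taylor_coefficients_eq_zero
      (c₀ := R₀ c * s d - R₀ d * s c - Complex.I * v * s b)
      (c₁ := R₁ c * s d - R₁ d * s c + Complex.I * (s c * Q₀ d - s d * Q₀ c) - Complex.I * s' b)
      (h := fun w => R₂ w c * s d - R₂ w d * s c + Complex.I * (s c * Q₁ w d - s d * Q₁ w c)
        + ((R₀ c + w * R₁ c + w ^ 2 * R₂ w c) * (Q₀ d + w * Q₁ w d)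
          - (R₀ d + w * R₁ d + w ^ 2 * R₂ w d) * (Q₀ c + w * Q₁ w c)) - W w b)
      (by fun_prop) (by
        filter_upwards [H, self_mem_nhdsWithin] with w hw hw0
        have hw0 : w ≠ 0 := hw0
        field_simp at hw
        apply mul_left_cancel₀ hw0
        linear_combination -hw)
    refine ⟨by linear_combination -A0, by linear_combination -A1, ?_⟩
    simp only [ne_eq, OfNat.ofNat_ne_zero, not_false_eq_true, zero_pow, zero_mul, add_zero] at A2
    linear_combination -A2
  have K0 := key 0 1 2 (by
    filter_upwards [H] with w hw; simpa [cross_apply] using congrFun hw 0)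
  have K1 := key 1 2 0 (by
    filter_upwards [H] with w hw; simpa [cross_apply] using congrFun hw 1)
  have K2 := key 2 0 1 (by
    filter_upwards [H] with w hw; simpa [cross_apply] using congrFun hw 2)
  refine ⟨?_, ?_, ?_⟩ <;> ext b <;> fin_cases b <;> simp [cross_apply]
  exacts [K0.1, K1.1, K2.1, K0.2.1, K1.2.1, K2.2.1, K0.2.2, K1.2.2, K2.2.2]

/-- The acceleration of a pole, from the Laurent coefficients of the equation. -/
lemma pole_acceleration {s s' R₀ R₁ R₂ Q₀ Q₁ W : Fin 3 → ℂ} {v v' : ℂ} (hs : s ≠ 0)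
    (ss : s ⬝ᵥ s = 0) (sR : R₀ ⬝ᵥ s = 0)
    (RR : Complex.I * (s ⬝ᵥ R₂) + R₀ ⬝ᵥ R₁ = 0)
    (h0 : (Complex.I * v) • s = crossProduct R₀ s)
    (h1 : Complex.I • s' = crossProduct R₁ s + Complex.I • crossProduct s Q₀)
    (h2 : W = crossProduct R₂ s + Complex.I • crossProduct s Q₁ + crossProduct R₀ Q₀)
    (hd : v' • s + v • s' = -Complex.I • (crossProduct (W + v • R₁) s + crossProduct R₀ s')) :
    v' = -(s ⬝ᵥ Q₁) - 2 * Complex.I * (s ⬝ᵥ R₂) := by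
  have hs' : s' = -Complex.I • crossProduct R₁ s + crossProduct s Q₀ := by
    have := congrArg (fun u => (-Complex.I) • u) h1
    simp only [smul_smul, smul_add] at this
    simpa using this
  subst h2
  -- As `s ≠ 0`, it suffices to compare multiples of `s`. With `s'` eliminated, each component is a
  -- polynomial identity modulo the sphere relations and the velocity relation `h0`.
  suffices h : v' • s = (-(s ⬝ᵥ Q₁) - 2 * Complex.I * (s ⬝ᵥ R₂)) • s from smul_left_injective ℂ hs h
  rw [hs'] at hd
  have hI := Complex.I_sq
  have a0 := congrFun h0 0
  have a1 := congrFun h0 1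
  have a2 := congrFun h0 2
  have b0 := congrFun hd 0
  have b1 := congrFun hd 1
  have b2 := congrFun hd 2
  simp [dotProduct, Fin.sum_univ_three, cross_apply, vecHead, vecTail] at a0 a1 a2 b0 b1 b2 ss sR RR ⊢
  ext b
  fin_cases b
  · change v' * s 0 = _ * s 0
    linear_combination b0 + ss * (Q₁ 0 + Complex.I * R₂ 0) - sR * R₁ 0 + s 0 * RR
      - Complex.I * (Q₀ 1 * a2 - Q₀ 2 * a1)
      + (R₀ 1 * (R₁ 0 * s 1 - R₁ 1 * s 0) - R₀ 2 * (R₁ 2 * s 0 - R₁ 0 * s 2)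
        + v * (Q₀ 1 * s 2 - Q₀ 2 * s 1)
        + s 0 * (s 1 * Q₁ 1 + s 2 * Q₁ 2) - Q₁ 0 * (s 1 ^ 2 + s 2 ^ 2)) * hI
  · change v' * s 1 = _ * s 1
    linear_combination b1 + ss * (Q₁ 1 + Complex.I * R₂ 1) - sR * R₁ 1 + s 1 * RR
      - Complex.I * (Q₀ 2 * a0 - Q₀ 0 * a2)
      + (R₀ 2 * (R₁ 1 * s 2 - R₁ 2 * s 1) - R₀ 0 * (R₁ 0 * s 1 - R₁ 1 * s 0)
        + v * (Q₀ 2 * s 0 - Q₀ 0 * s 2)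
        + s 1 * (s 2 * Q₁ 2 + s 0 * Q₁ 0) - Q₁ 1 * (s 2 ^ 2 + s 0 ^ 2)) * hI
  · change v' * s 2 = _ * s 2
    linear_combination b2 + ss * (Q₁ 2 + Complex.I * R₂ 2) - sR * R₁ 2 + s 2 * RR
      - Complex.I * (Q₀ 0 * a1 - Q₀ 1 * a0)
      + (R₀ 0 * (R₁ 2 * s 0 - R₁ 0 * s 2) - R₀ 1 * (R₁ 1 * s 2 - R₁ 2 * s 1)
        + v * (Q₀ 0 * s 1 - Q₀ 1 * s 0)
        + s 2 * (s 0 * Q₁ 0 + s 1 * Q₁ 1) - Q₁ 2 * (s 0 ^ 2 + s 1 ^ 2)) * hI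

end LaurentAlgebra

/-- The `p`-th order interaction of the pole `k` with the other poles, of weights `c`. -/
noncomputable def interaction {ι : Type*} [Fintype ι] [DecidableEq ι] (a : ι → ℂ) (k : ι)
    (p : ℕ) (c : ι → ℂ) : ℂ :=
  ∑ l ∈ Finset.univ.erase k, c l / (a k - a l) ^ p

section Laurent
open Matrix

variable {ι : Type*} [Fintype ι] [DecidableEq ι]

/-- With `z = a k + w`, the other poles contribute only regular terms. `R₀`, `R₁`, `R₂` are the
Taylor coefficients of the regular part of the map, `Q₀`, `Q₁` those of its half-Laplacian, and `W`
is the constant term of the time derivative. -/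
lemma laurent_of_simple_poles {a : ι → ℂ} (ha : Function.Injective a) {d d' : ι → Fin 3 → ℂ}
    {ε v : ι → ℂ} {m₀ : Fin 3 → ℂ}
    (HM : ∀ z, (∀ l, z ≠ a l) → ∑ b, (m₀ b + Complex.I * ∑ l, ε l * d l b / (z - a l)) ^ 2 = 1)
    (HE : ∀ z, (∀ l, z ≠ a l) →
      (fun b => Complex.I * ∑ l, (ε l * d' l b / (z - a l) + ε l * d l b * v l / (z - a l) ^ 2)) =
      crossProduct (fun b => m₀ b + Complex.I * ∑ l, ε l * d l b / (z - a l))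
        (fun b => ∑ l, d l b / (z - a l) ^ 2))
    {k : ι} (hk : ε k = 1) {R₀ R₁ R₂ Q₀ Q₁ W : Fin 3 → ℂ}
    (hR₀ : ∀ b, R₀ b = m₀ b + Complex.I * interaction a k 1 (fun l => ε l * d l b))
    (hR₁ : ∀ b, R₁ b = -Complex.I * interaction a k 2 (fun l => ε l * d l b))
    (hR₂ : ∀ b, R₂ b = Complex.I * interaction a k 3 (fun l => ε l * d l b))
    (hQ₀ : ∀ b, Q₀ b = interaction a k 2 (fun l => d l b))
    (hQ₁ : ∀ b, Q₁ b = -2 * interaction a k 3 (fun l => d l b))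
    (hW : ∀ b, W b = Complex.I * (interaction a k 1 (fun l => ε l * d' l b)
      + interaction a k 2 (fun l => ε l * d l b * v l))) :
    d k ⬝ᵥ d k = 0 ∧ R₀ ⬝ᵥ d k = 0 ∧ Complex.I * (d k ⬝ᵥ R₂) + R₀ ⬝ᵥ R₁ = 0 ∧
    (Complex.I * v k) • d k = crossProduct R₀ (d k) ∧
    Complex.I • d' k = crossProduct R₁ (d k) + Complex.I • crossProduct (d k) Q₀ ∧
    W = crossProduct R₂ (d k) + Complex.I • crossProduct (d k) Q₁ + crossProduct R₀ Q₀ := by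
  have hA : ∀ l ∈ Finset.univ.erase k, a k - a l ≠ 0 := fun l hl =>
    sub_ne_zero.2 fun h => (Finset.ne_of_mem_erase hl) (ha h).symm
  have hev : ∀ᶠ w in 𝓝[≠] (0 : ℂ), w ≠ 0 ∧ (∀ l, a k + w ≠ a l) := by
    refine (eventually_mem_nhdsWithin (a := (0:ℂ)) (s := {0}ᶜ)).and (eventually_all.2 fun l => ?_)
    by_cases hl : l = k
    · subst hl
      filter_upwards [self_mem_nhdsWithin] with w hw h
      exact hw (by simpa using h)
    · have : ContinuousAt (fun w : ℂ => a k + w) 0 := by fun_prop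
      refine (this.eventually_ne ?_).filter_mono nhdsWithin_le_nhds
      simpa using fun h => hl (ha h).symm
  -- Exact remainders, with `A = a k - a l`: `1/(A + w) = 1/A - w/A² + w²/(A² (A + w))` and `1/(A +
  -- w)² = 1/A² - w (2A + w)/(A² (A + w)²)`.
  let r₂ : ℂ → Fin 3 → ℂ := fun w b => Complex.I * ∑ l ∈ Finset.univ.erase k,
    ε l * d l b / ((a k - a l) ^ 2 * (a k - a l + w))
  let q₁ : ℂ → Fin 3 → ℂ := fun w b => ∑ l ∈ Finset.univ.erase k,
    d l b * -(2 * (a k - a l) + w) / ((a k - a l) ^ 2 * (a k - a l + w) ^ 2)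
  let W' : ℂ → Fin 3 → ℂ := fun w b => Complex.I * ∑ l ∈ Finset.univ.erase k,
    (ε l * d' l b / (a k - a l + w) + ε l * d l b * v l / (a k - a l + w) ^ 2)
  have cr : ∀ b, ContinuousAt (fun w => r₂ w b) 0 := fun b => by
    refine continuousAt_const.mul (tendsto_finsetSum _ fun l hl => ?_)
    have := hA l hl
    exact ContinuousAt.div (by fun_prop) (by fun_prop) (by simp [this])
  have cq : ∀ b, ContinuousAt (fun w => q₁ w b) 0 := fun b => by
    refine tendsto_finsetSum _ fun l hl => ?_
    have := hA l hl
    exact ContinuousAt.div (by fun_prop) (by fun_prop) (by simp [this])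
  have cW : ∀ b, ContinuousAt (fun w => W' w b) 0 := fun b => by
    refine continuousAt_const.mul (tendsto_finsetSum _ fun l hl => ?_)
    have := hA l hl
    exact (ContinuousAt.div (by fun_prop) (by fun_prop) (by simp [this])).add
      (ContinuousAt.div (by fun_prop) (by fun_prop) (by simp [this]))
  have er : r₂ 0 = R₂ := by
    ext b
    rw [hR₂]
    simp only [r₂, interaction, add_zero]
    simp only [← pow_succ]
  have eq : q₁ 0 = Q₁ := by
    ext b
    rw [hQ₁]
    simp only [q₁, interaction, add_zero, Finset.mul_sum]
    refine Finset.sum_congr rfl fun l hl => ?_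
    have := hA l hl
    field_simp
  have eW : W' 0 = W := by
    ext b
    rw [hW]
    simp only [W', interaction, add_zero, ← Finset.sum_add_distrib, pow_one]
  have sR : ∀ w ≠ 0, (∀ l, a k + w ≠ a l) → ∀ b,
      m₀ b + Complex.I * ∑ l, ε l * d l b / (a k + w - a l) =
        Complex.I * d k b / w + (R₀ b + w * R₁ b + w ^ 2 * r₂ w b) := by
    intro w hw hl b
    have e : ∑ l ∈ Finset.univ.erase k, ε l * d l b / (a k + w - a l) =
        interaction a k 1 (fun l => ε l * d l b) - w * interaction a k 2 (fun l => ε l * d l b)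
        + w ^ 2 * ∑ l ∈ Finset.univ.erase k,
          ε l * d l b / ((a k - a l) ^ 2 * (a k - a l + w)) := by
      simp only [interaction, Finset.mul_sum]
      rw [← Finset.sum_sub_distrib, ← Finset.sum_add_distrib]
      refine Finset.sum_congr rfl fun l h => ?_
      have h1 := hA l h
      have h2 : a k - a l + w ≠ 0 := fun h => hl l (by linear_combination h)
      have h3 : a k + w - a l = a k - a l + w := by ring
      rw [h3]
      field_simp
      ring
    rw [← Finset.add_sum_erase _ _ (Finset.mem_univ k), e, hk, hR₀, hR₁]
    simp only [r₂]
    rw [add_sub_cancel_left]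
    ring
  have sQ : ∀ w ≠ 0, (∀ l, a k + w ≠ a l) → ∀ b,
      ∑ l, d l b / (a k + w - a l) ^ 2 = d k b / w ^ 2 + (Q₀ b + w * q₁ w b) := by
    intro w hw hl b
    have e : ∑ l ∈ Finset.univ.erase k, d l b / (a k + w - a l) ^ 2 = Q₀ b + w * q₁ w b := by
      rw [hQ₀]
      simp only [interaction, q₁, Finset.mul_sum]
      rw [← Finset.sum_add_distrib]
      refine Finset.sum_congr rfl fun l h => ?_
      have h1 := hA l h
      have h2 : a k - a l + w ≠ 0 := fun h => hl l (by linear_combination h)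
      have h3 : a k + w - a l = a k - a l + w := by ring
      rw [h3]
      field_simp
      ring
    rw [← Finset.add_sum_erase _ _ (Finset.mem_univ k), e, add_sub_cancel_left]
  have sW : ∀ w ≠ 0, (∀ l, a k + w ≠ a l) → ∀ b,
      Complex.I * ∑ l, (ε l * d' l b / (a k + w - a l) + ε l * d l b * v l / (a k + w - a l) ^ 2) =
        Complex.I * d' k b / w + Complex.I * v k * d k b / w ^ 2 + W' w b := by
    intro w hw hl b
    rw [← Finset.add_sum_erase _ _ (Finset.mem_univ k), add_sub_cancel_left, hk]
    simp only [W']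
    have h3 : ∀ l, a k + w - a l = a k - a l + w := fun l => by ring
    simp only [h3]
    ring
  obtain ⟨A0, A1, A2⟩ := laurent_sphere (s := d k) (R₀ := R₀) (R₁ := R₁) cr (by
    filter_upwards [hev] with w hw
    rw [← HM (a k + w) hw.2]
    exact Finset.sum_congr rfl fun b _ => by rw [sR w hw.1 hw.2])
  obtain ⟨B0, B1, B2⟩ := laurent_equation (s := d k) (s' := d' k) (R₀ := R₀) (R₁ := R₁) (Q₀ := Q₀)
    (v := v k) cr cq cW (by
    filter_upwards [hev] with w hw
    have := HE (a k + w) hw.2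
    simp only [sR w hw.1 hw.2, sQ w hw.1 hw.2, sW w hw.1 hw.2] at this
    exact this)
  rw [er] at A2 B2
  rw [eq, eW] at B2
  exact ⟨A0, A1, A2, B0, B1, B2⟩

end Laurent

/-! ### Equations of motion of spins and poles. -/

section Dynamics
open Matrix

variable {ι : Type*} [Fintype ι] [DecidableEq ι]

lemma HasDerivWithinAt.crossProduct_complex {f g : ℝ → Fin 3 → ℂ} {f' g' : Fin 3 → ℂ}
    {T : Set ℝ} {t : ℝ} (hf : HasDerivWithinAt f f' T t) (hg : HasDerivWithinAt g g' T t) :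
    HasDerivWithinAt (fun τ => crossProduct (f τ) (g τ))
      (crossProduct f' (g t) + crossProduct (f t) g') T t := by
  rw [hasDerivWithinAt_pi] at hf hg ⊢
  have key : ∀ b c, HasDerivWithinAt (fun τ => f τ b * g τ c - f τ c * g τ b)
      (f' b * g t c - f' c * g t b + (f t b * g' c - f t c * g' b)) T t := fun b c => by
    refine (((hf b).mul (hg c)).sub ((hf c).mul (hg b))).congr_deriv ?_
    ring
  intro b
  fin_cases b <;> simp [cross_apply]
  exacts [key 1 2, key 2 0, key 0 1]

/-- The derivative is split so that, applied to `R₀`, it reads `W + v k • R₁`, the combination that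
the Laurent relations control. -/
lemma HasDerivWithinAt.interaction_one {a c : ι → ℝ → ℂ} {v c' : ι → ℂ} {T : Set ℝ} {t : ℝ}
    (ha : ∀ l, HasDerivWithinAt (a l) (v l) T t) (hinj : Function.Injective fun l => a l t)
    (hc : ∀ l, HasDerivWithinAt (c l) (c' l) T t) (k : ι) :
    HasDerivWithinAt (fun τ => interaction (fun l => a l τ) k 1 (fun l => c l τ))
      (interaction (fun l => a l t) k 1 c' + interaction (fun l => a l t) k 2 (fun l => c l t * v l)
        - v k * interaction (fun l => a l t) k 2 (fun l => c l t)) T t := by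
  have hA : ∀ l ∈ Finset.univ.erase k, a k t - a l t ≠ 0 := fun l hl =>
    sub_ne_zero.2 fun h => (Finset.ne_of_mem_erase hl) (hinj h).symm
  have := HasDerivWithinAt.fun_sum (u := Finset.univ.erase k) fun l hl =>
    (hc l).fun_div (((ha k).sub (ha l))) (hA l hl)
  simp only [interaction, pow_one]
  refine this.congr_deriv ?_
  rw [Finset.mul_sum, ← Finset.sum_add_distrib, ← Finset.sum_sub_distrib]
  refine Finset.sum_congr rfl fun l hl => ?_
  have := hA l hl
  simp only [Pi.sub_apply]
  field_simp
  ring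

/-- Equations of motion of the poles of positive sign. -/
lemma hasDerivWithinAt_velocity {T : Set ℝ} (hT : UniqueDiffOn ℝ T) {a v : ι → ℝ → ℂ}
    {d d' : ι → ℝ → Fin 3 → ℂ} {ε : ι → ℂ} {m₀ : Fin 3 → ℂ}
    (ha : ∀ t ∈ T, Function.Injective fun l => a l t)
    (hv : ∀ l, ∀ t ∈ T, HasDerivWithinAt (a l) (v l t) T t)
    (hd : ∀ l, ∀ t ∈ T, HasDerivWithinAt (d l) (d' l t) T t)
    (HM : ∀ t ∈ T, ∀ z, (∀ l, z ≠ a l t) →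
      ∑ b, (m₀ b + Complex.I * ∑ l, ε l * d l t b / (z - a l t)) ^ 2 = 1)
    (HE : ∀ t ∈ T, ∀ z, (∀ l, z ≠ a l t) →
      (fun b => Complex.I * ∑ l,
        (ε l * d' l t b / (z - a l t) + ε l * d l t b * v l t / (z - a l t) ^ 2)) =
      crossProduct (fun b => m₀ b + Complex.I * ∑ l, ε l * d l t b / (z - a l t))
        (fun b => ∑ l, d l t b / (z - a l t) ^ 2))
    {k : ι} (hk : ε k = 1) (hd0 : ∀ t ∈ T, d k t ≠ 0) {t : ℝ} (ht : t ∈ T) :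
    HasDerivWithinAt (v k)
      (2 * ∑ l ∈ Finset.univ.erase k, (1 + ε l) * (d k t ⬝ᵥ d l t) / (a k t - a l t) ^ 3) T t := by
  let R₀ : ℝ → Fin 3 → ℂ := fun τ b =>
    m₀ b + Complex.I * interaction (fun l => a l τ) k 1 (fun l => ε l * d l τ b)
  let R₁ : ℝ → Fin 3 → ℂ := fun τ b =>
    -Complex.I * interaction (fun l => a l τ) k 2 (fun l => ε l * d l τ b)
  let R₂ : ℝ → Fin 3 → ℂ := fun τ b =>
    Complex.I * interaction (fun l => a l τ) k 3 (fun l => ε l * d l τ b)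
  let Q₀ : ℝ → Fin 3 → ℂ := fun τ b => interaction (fun l => a l τ) k 2 (fun l => d l τ b)
  let Q₁ : ℝ → Fin 3 → ℂ := fun τ b => -2 * interaction (fun l => a l τ) k 3 (fun l => d l τ b)
  let W : ℝ → Fin 3 → ℂ := fun τ b => Complex.I *
    (interaction (fun l => a l τ) k 1 (fun l => ε l * d' l τ b)
      + interaction (fun l => a l τ) k 2 (fun l => ε l * d l τ b * v l τ))
  have L := fun τ (hτ : τ ∈ T) => laurent_of_simple_poles (ha τ hτ) (HM τ hτ) (HE τ hτ) hk
    (R₀ := R₀ τ) (R₁ := R₁ τ) (R₂ := R₂ τ) (Q₀ := Q₀ τ) (Q₁ := Q₁ τ) (W := W τ) (fun _ => rfl)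
    (fun _ => rfl) (fun _ => rfl) (fun _ => rfl) (fun _ => rfl) (fun _ => rfl)
  have hR₀ : HasDerivWithinAt R₀ (W t + v k t • R₁ t) T t := by
    rw [hasDerivWithinAt_pi]
    intro b
    have := ((HasDerivWithinAt.interaction_one (c := fun l τ => ε l * d l τ b) (fun l => hv l t ht)
      (ha t ht) (fun l => ((hasDerivWithinAt_pi.1 (hd l t ht)) b).const_mul (ε l)) k).const_mul
        Complex.I).const_add (m₀ b)
    refine this.congr_deriv ?_
    simp only [W, R₁, Pi.add_apply, Pi.smul_apply, smul_eq_mul]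
    ring
  have hcross := HasDerivWithinAt.crossProduct_complex hR₀ (hd k t ht)
  -- The poles are only assumed once differentiable. The velocity is differentiable because `I v d =
  -- R₀ × d` expresses it as a quotient in any component where the spin is nonzero.
  have hvk : ∃ v', HasDerivWithinAt (v k) v' T t := by
    obtain ⟨b, hb⟩ := Function.ne_iff.1 (hd0 t ht)
    have hdb := hasDerivWithinAt_pi.1 (hd k t ht) b
    have hcb := hasDerivWithinAt_pi.1 hcross b
    have hne : Complex.I * d k t b ≠ 0 := mul_ne_zero Complex.I_ne_zero hb
    have hq := hcb.fun_div (hdb.const_mul Complex.I) hne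
    refine ⟨_, hq.congr_of_eventuallyEq_of_mem ?_ ht⟩
    filter_upwards [hdb.continuousWithinAt.eventually_ne hb, self_mem_nhdsWithin] with τ h1 h2
    have := congrFun (L τ h2).2.2.2.1 b
    simp only [Pi.smul_apply, smul_eq_mul] at this
    rw [← this]
    have hI := Complex.I_ne_zero
    have h1 : d k τ b ≠ 0 := h1
    field_simp
  obtain ⟨v', hv'⟩ := hvk
  obtain ⟨L0, L1, L2, L3, L4, L5⟩ := L t ht
  have hl : HasDerivWithinAt (fun τ => (Complex.I * v k τ) • d k τ)
      ((Complex.I * v k t) • d' k t + (Complex.I * v') • d k t) T t :=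
    (hv'.const_mul Complex.I).fun_smul (hd k t ht)
  -- The relation `I v d = R₀ × d` is differentiated on both sides; uniqueness of the derivative
  -- equates the results.
  have hEq := (hT t ht).eq_deriv _ hl
    (hcross.congr (fun τ hτ => (L τ hτ).2.2.2.1) L3)
  have := pole_acceleration (v' := v') (hd0 t ht) L0 L1 L2 L3 L4 L5 (by
    rw [← hEq]
    ext b
    simp only [Pi.add_apply, Pi.smul_apply, smul_eq_mul]
    linear_combination (v' * d k t b + v k t * d' k t b) * Complex.I_sq)
  refine hv'.congr_deriv ?_
  rw [this]
  simp only [dotProduct, Q₁, R₂, interaction, Fin.sum_univ_three, Finset.mul_sum,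
    ← Finset.sum_add_distrib, ← Finset.sum_sub_distrib, ← Finset.sum_neg_distrib]
  refine Finset.sum_congr rfl fun l _ => ?_
  linear_combination (-2 * ε l * (d k t 0 * d l t 0 + d k t 1 * d l t 1 + d k t 2 * d l t 2)
    / (a k t - a l t) ^ 3) * Complex.I_sq

/-- In the order `1/w` relation, `Q₀` carries weight `1` and `R₁` carries weight `ε l`. They add up
to `1 + ε l`, so poles of sign `-1` exert no force. -/
lemma spin_equation {a v : ι → ℂ} (ha : Function.Injective a)
    {d d' : ι → Fin 3 → ℂ} {ε : ι → ℂ} {m₀ : Fin 3 → ℂ}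
    (HM : ∀ z, (∀ l, z ≠ a l) → ∑ b, (m₀ b + Complex.I * ∑ l, ε l * d l b / (z - a l)) ^ 2 = 1)
    (HE : ∀ z, (∀ l, z ≠ a l) →
      (fun b => Complex.I * ∑ l, (ε l * d' l b / (z - a l) + ε l * d l b * v l / (z - a l) ^ 2)) =
      crossProduct (fun b => m₀ b + Complex.I * ∑ l, ε l * d l b / (z - a l))
        (fun b => ∑ l, d l b / (z - a l) ^ 2))
    {k : ι} (hk : ε k = 1) :
    d' k = crossProduct (d k) (∑ l ∈ Finset.univ.erase k, ((1 + ε l) / (a k - a l) ^ 2) • d l) := by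
  obtain ⟨-, -, -, -, h, -⟩ := laurent_of_simple_poles ha HM HE hk
    (R₁ := fun b => -Complex.I * interaction a k 2 (fun l => ε l * d l b))
    (Q₀ := fun b => interaction a k 2 (fun l => d l b)) (fun _ => rfl) (fun _ => rfl)
    (fun _ => rfl) (fun _ => rfl) (fun _ => rfl) (fun _ => rfl)
  have e : ∑ l ∈ Finset.univ.erase k, ((1 + ε l) / (a k - a l) ^ 2) • d l =
      (fun b => interaction a k 2 (fun l => d l b)) +
      Complex.I • (fun b => -Complex.I * interaction a k 2 (fun l => ε l * d l b)) := by
    ext b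
    simp only [interaction, Finset.sum_apply, Pi.add_apply, Pi.smul_apply, smul_eq_mul]
    rw [← mul_assoc, mul_neg, Complex.I_mul_I, neg_neg, one_mul, ← Finset.sum_add_distrib]
    exact Finset.sum_congr rfl fun l _ => by ring
  rw [e, map_add, map_smul]
  apply smul_right_injective _ Complex.I_ne_zero
  dsimp only
  rw [h, smul_add, smul_smul, Complex.I_mul_I, neg_one_smul, ← cross_anticomm, add_comm]
end Dynamics

/-! ### Residue bound by Blaschke products. -/

lemma norm_sub_le_norm_sub_conj {z a : ℂ} (hz : 0 ≤ z.im) (ha : 0 ≤ a.im) :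
    ‖z - a‖ ≤ ‖z - (starRingEnd ℂ) a‖ := by
  rw [← sq_le_sq₀ (norm_nonneg _) (norm_nonneg _), ← Complex.normSq_eq_norm_sq,
    ← Complex.normSq_eq_norm_sq, Complex.normSq_apply, Complex.normSq_apply]
  simp
  nlinarith [mul_nonneg hz ha]

lemma im_le_norm_sub_conj {z a : ℂ} (hz : 0 ≤ z.im) : a.im ≤ ‖z - (starRingEnd ℂ) a‖ := by
  have := Complex.abs_im_le_norm (z - (starRingEnd ℂ) a)
  simp only [Complex.sub_im, Complex.conj_im] at this
  linarith [le_abs_self (z.im - -a.im)]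

/-- A function on the closed upper half-plane which is bounded there, and bounded by `1` on the
real line, is bounded by `1`. -/
lemma norm_le_one_of_upperHalfPlane {g : ℂ → ℂ} (hg : ∀ z : ℂ, 0 ≤ z.im → DifferentiableAt ℂ g z)
    {C : ℝ} (hC : ∀ z : ℂ, 0 ≤ z.im → ‖g z‖ ≤ C) (h1 : ∀ y : ℝ, ‖g y‖ ≤ 1) {z : ℂ}
    (hz : 0 ≤ z.im) : ‖g z‖ ≤ 1 := by
  -- A quarter turn carries the upper half-plane to the right half-plane, where Phragmén–Lindelöf is
  -- available.
  let f : ℂ → ℂ := fun w => g (Complex.I * w)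
  have hf : ∀ w : ℂ, 0 ≤ w.re → DifferentiableAt ℂ f w := fun w hw =>
    DifferentiableAt.comp (g := g) w (hg _ (by simpa using hw)) (by fun_prop)
  have hb : ∀ w : ℂ, 0 ≤ w.re → ‖f w‖ ≤ C := fun w hw => hC _ (by simpa using hw)
  have := PhragmenLindelof.right_half_plane_of_bounded_on_real (f := f) (C := 1)
    (z := -Complex.I * z) ?_ ?_ ?_ ?_ (by simpa using hz)
  · simpa [f, ← mul_assoc] using this
  · refine DifferentiableOn.diffContOnCl fun w hw => (hf w ?_).differentiableWithinAt
    rw [Complex.closure_setOfPred_lt_re] at hw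
    exact hw
  · refine ⟨0, by norm_num, 0, ?_⟩
    refine Asymptotics.IsBigO.of_bound C ?_
    filter_upwards [mem_inf_of_right (mem_principal_self _)] with w hw
    simpa using hb w (le_of_lt hw)
  · refine isBoundedUnder_of_eventually_le (a := C) ?_
    filter_upwards [eventually_ge_atTop 0] with r hr
    exact hb r (by simpa using hr)
  · intro y
    have e : Complex.I * (y * Complex.I) = ((-y : ℝ) : ℂ) := by
      push_cast
      linear_combination (y : ℂ) * Complex.I_sq
    change ‖g (Complex.I * (y * Complex.I))‖ ≤ 1
    rw [e]
    exact h1 (-y)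

/-- Residues of a rational function that is bounded by `1` on the real line. -/
lemma norm_residue_le {ι : Type*} [Fintype ι] [DecidableEq ι] {x s r : ι → ℂ} {c : ℂ}
    (hx : ∀ k, 0 < (x k).im) (hinj : Function.Injective x)
    (hb : ∀ y : ℝ, ‖c + Complex.I * ∑ k, s k / ((y : ℂ) - x k)
      - Complex.I * ∑ k, r k / ((y : ℂ) - (starRingEnd ℂ) (x k))‖ ≤ 1) (j : ι) :
    ‖s j‖ ≤ 2 * (x j).im *
      ∏ k ∈ Finset.univ.erase j, (‖x j - (starRingEnd ℂ) (x k)‖ / ‖x j - x k‖) := by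
  have nz : ∀ z : ℂ, 0 ≤ z.im → ∀ k, z - (starRingEnd ℂ) (x k) ≠ 0 := fun z hz k h => by
    have := congrArg Complex.im h
    simp at this
    linarith [hx k]
  let β : ι → ℂ → ℂ := fun k z => (z - x k) / (z - (starRingEnd ℂ) (x k))
  -- The rational function times the Blaschke product of all `x k`, with the poles cancelled by
  -- hand: dividing `β j` by `z - x j` leaves the denominator with the conjugate and the product
  -- over the others.
  let g : ℂ → ℂ := fun z => c * ∏ k, β k z
    + Complex.I * ∑ j, s j / (z - (starRingEnd ℂ) (x j)) * ∏ k ∈ Finset.univ.erase j, β k z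
    - Complex.I * ∑ j, r j / (z - (starRingEnd ℂ) (x j)) * ∏ k, β k z
  have dβ : ∀ z : ℂ, 0 ≤ z.im → ∀ k, DifferentiableAt ℂ (β k) z := fun z hz k =>
    DifferentiableAt.div (by fun_prop) (by fun_prop) (nz z hz k)
  have dr : ∀ z : ℂ, 0 ≤ z.im → ∀ k (u : ℂ),
      DifferentiableAt ℂ (fun z => u / (z - (starRingEnd ℂ) (x k))) z := fun z hz k u =>
    DifferentiableAt.div (by fun_prop) (by fun_prop) (nz z hz k)
  have hg : ∀ z : ℂ, 0 ≤ z.im → DifferentiableAt ℂ g z := by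
    intro z hz
    have p : ∀ S : Finset ι, DifferentiableAt ℂ (fun z => ∏ k ∈ S, β k z) z := fun S =>
      DifferentiableAt.fun_finsetProd fun k _ => dβ z hz k
    refine (((p _).const_mul c).add (DifferentiableAt.const_mul ?_ _)).sub
      (DifferentiableAt.const_mul ?_ _)
    · exact DifferentiableAt.fun_sum fun k _ => (dr z hz k _).mul (p _)
    · exact DifferentiableAt.fun_sum fun k _ => (dr z hz k _).mul (p _)
  have bβ : ∀ z : ℂ, 0 ≤ z.im → ∀ S : Finset ι, ‖∏ k ∈ S, β k z‖ ≤ 1 := by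
    intro z hz S
    rw [norm_prod]
    refine Finset.prod_le_one (fun _ _ => norm_nonneg _) fun k _ => ?_
    rw [norm_div]
    exact div_le_one_of_le₀ (norm_sub_le_norm_sub_conj hz (hx k).le) (norm_nonneg _)
  have br : ∀ z : ℂ, 0 ≤ z.im → ∀ k (u : ℂ),
      ‖u / (z - (starRingEnd ℂ) (x k))‖ ≤ ‖u‖ / (x k).im := fun z hz k u => by
    rw [norm_div]
    exact div_le_div_of_nonneg_left (norm_nonneg _) (hx k) (im_le_norm_sub_conj hz)
  have hC : ∀ z : ℂ, 0 ≤ z.im →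
      ‖g z‖ ≤ ‖c‖ + ∑ k, ‖s k‖ / (x k).im + ∑ k, ‖r k‖ / (x k).im := by
    intro z hz
    have t : ∀ (u : ι → ℂ) (S : ι → Finset ι),
        ‖Complex.I * ∑ j, u j / (z - (starRingEnd ℂ) (x j)) * ∏ k ∈ S j, β k z‖
          ≤ ∑ k, ‖u k‖ / (x k).im := fun u S => by
      rw [norm_mul, Complex.norm_I, one_mul]
      refine norm_sum_le_of_le _ fun k _ => ?_
      rw [norm_mul]
      exact (mul_le_of_le_one_right (norm_nonneg _) (bβ z hz _)).trans (br z hz k _)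
    refine (norm_sub_le _ _).trans (add_le_add ((norm_add_le _ _).trans (add_le_add ?_ (t _ _)))
      (t _ _))
    rw [norm_mul]
    exact mul_le_of_le_one_right (norm_nonneg _) (bβ z hz _)
  have h1 : ∀ y : ℝ, ‖g y‖ ≤ 1 := by
    intro y
    have hy : ∀ k, (y : ℂ) - x k ≠ 0 := fun k h => by
      have := congrArg Complex.im h
      simp at this
      linarith [hx k]
    have e : g y = (c + Complex.I * ∑ k, s k / ((y : ℂ) - x k)
      - Complex.I * ∑ k, r k / ((y : ℂ) - (starRingEnd ℂ) (x k))) * ∏ k, β k y := by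
      have e1 : ∑ j, s j / ((y : ℂ) - (starRingEnd ℂ) (x j)) * ∏ k ∈ Finset.univ.erase j, β k y
          = (∑ k, s k / ((y : ℂ) - x k)) * ∏ k, β k y := by
        rw [Finset.sum_mul]
        refine Finset.sum_congr rfl fun k _ => ?_
        rw [← Finset.mul_prod_erase _ _ (Finset.mem_univ k), ← mul_assoc]
        congr 1
        have := hy k
        have := nz y (by simp) k
        simp only [β]
        field_simp
      simp only [g]
      rw [e1, ← Finset.sum_mul]
      ring
    rw [e, norm_mul]
    exact mul_le_one₀ (hb y) (norm_nonneg _) (bβ y (by simp) _)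
  -- Every term that retains the factor `β j` vanishes at `x j`; only the residue term of `j`
  -- survives.
  have hval : g (x j) = Complex.I * (s j / (x j - (starRingEnd ℂ) (x j)) *
      ∏ k ∈ Finset.univ.erase j, β k (x j)) := by
    have hB : ∏ k, β k (x j) = 0 := Finset.prod_eq_zero (Finset.mem_univ j) (by simp [β])
    simp only [g]
    rw [hB, ← Finset.add_sum_erase _ _ (Finset.mem_univ j), Finset.sum_eq_zero
      (s := Finset.univ.erase j)]
    · simp
    · intro k hk
      rw [Finset.prod_eq_zero (i := j), mul_zero]
      · simpa using (Finset.ne_of_mem_erase hk).symm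
      · simp [β]
  have hle := norm_le_one_of_upperHalfPlane hg hC h1 (hx j).le
  have hn : ‖x j - (starRingEnd ℂ) (x j)‖ = 2 * (x j).im := by
    rw [Complex.sub_conj]
    simp [abs_of_pos (hx j)]
  rw [hval, norm_mul, norm_mul, norm_div, norm_prod, Complex.norm_I, one_mul, hn] at hle
  have hp : (∏ k ∈ Finset.univ.erase j, ‖β k (x j)‖) *
      ∏ k ∈ Finset.univ.erase j, (‖x j - (starRingEnd ℂ) (x k)‖ / ‖x j - x k‖) = 1 := by
    rw [← Finset.prod_mul_distrib]
    refine Finset.prod_eq_one fun k hk => ?_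
    have a1 : ‖x j - x k‖ ≠ 0 := norm_ne_zero_iff.2 (sub_ne_zero.2 fun h =>
      (Finset.ne_of_mem_erase hk) (hinj h).symm)
    have a2 : ‖x j - (starRingEnd ℂ) (x k)‖ ≠ 0 := norm_ne_zero_iff.2 (nz _ (hx j).le k)
    simp only [β, norm_div]
    field_simp
  have hpos : 0 ≤ ∏ k ∈ Finset.univ.erase j, (‖x j - (starRingEnd ℂ) (x k)‖ / ‖x j - x k‖) :=
    Finset.prod_nonneg fun k _ => by positivity
  have h2 : 0 < 2 * (x j).im := by linarith [hx j]
  have := mul_le_mul_of_nonneg_right hle (mul_nonneg h2.le hpos)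
  calc ‖s j‖ = ‖s j‖ / (2 * (x j).im) * (∏ k ∈ Finset.univ.erase j, ‖β k (x j)‖) *
        (2 * (x j).im * ∏ k ∈ Finset.univ.erase j,
          (‖x j - (starRingEnd ℂ) (x k)‖ / ‖x j - x k‖)) := by
        rw [mul_mul_mul_comm, hp, mul_one, div_mul_cancel₀ _ h2.ne']
    _ ≤ _ := by linarith

/-! ### Grönwall estimates. -/

section Gronwall

variable {E : Type*} [NormedAddCommGroup E] [NormedSpace ℝ E]

lemma norm_le_norm_mul_exp_of_le {f f' : ℝ → E} {K a b : ℝ} (hab : a ≤ b)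
    (hf : ∀ t ∈ Set.Icc a b, HasDerivWithinAt f (f' t) (Set.Icc a b) t)
    (hK : ∀ t ∈ Set.Icc a b, ‖f' t‖ ≤ K * ‖f t‖) : ‖f b‖ ≤ ‖f a‖ * Real.exp (K * (b - a)) := by
  have := norm_le_gronwallBound_of_norm_deriv_right_le (f := f) (f' := f') (δ := ‖f a‖) (K := K)
    (ε := 0) (a := a) (b := b) (fun t ht => (hf t ht).continuousWithinAt)
    (fun t ht => (hf t ⟨ht.1, ht.2.le⟩).mono_of_mem_nhdsWithin
      (mem_of_superset (Icc_mem_nhdsGE ht.2) (Set.Icc_subset_Icc_left ht.1))) le_rfl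
    (fun t ht => by simpa using hK t ⟨ht.1, ht.2.le⟩) b ⟨hab, le_rfl⟩
  rwa [gronwallBound_ε0] at this

/-- Grönwall's inequality in both directions of time. -/
lemma norm_le_norm_mul_exp {f f' : ℝ → E} {K : ℝ} {T : Set ℝ} {t₁ t₂ : ℝ}
    (hT : Set.uIcc t₁ t₂ ⊆ T) (hf : ∀ t ∈ T, HasDerivWithinAt f (f' t) T t)
    (hK : ∀ t ∈ Set.uIcc t₁ t₂, ‖f' t‖ ≤ K * ‖f t‖) :
    ‖f t₂‖ ≤ ‖f t₁‖ * Real.exp (K * |t₂ - t₁|) := by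
  rcases le_total t₁ t₂ with h | h
  · rw [Set.uIcc_of_le h] at hT hK
    rw [abs_of_nonneg (by linarith)]
    exact norm_le_norm_mul_exp_of_le h (fun t ht => (hf t (hT ht)).mono hT) hK
  · rw [Set.uIcc_of_ge h] at hT hK
    rw [abs_of_nonpos (by linarith), neg_sub]
    have hmap : ∀ t ∈ Set.Icc t₂ t₁, t₁ + t₂ - t ∈ Set.Icc t₂ t₁ := fun t ht =>
      ⟨by linarith [ht.2], by linarith [ht.1]⟩
    have := norm_le_norm_mul_exp_of_le (f := fun t => f (t₁ + t₂ - t))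
      (f' := fun t => -f' (t₁ + t₂ - t)) (K := K) h ?_ ?_
    · simpa using this
    · intro t ht
      have h1 := (hf _ (hT (hmap t ht))).mono hT
      have h2 : HasDerivWithinAt (fun t => t₁ + t₂ - t) (-1) (Set.Icc t₂ t₁) t := by
        simpa using (hasDerivWithinAt_id t (Set.Icc t₂ t₁)).const_sub (t₁ + t₂)
      simpa [Function.comp_def] using h1.scomp t h2 (fun t ht => hmap t ht)
    · intro t ht
      simpa using hK _ (hmap t ht)

end Gronwall

lemma norm_crossProduct_le (u w : Fin 3 → ℂ) : ‖crossProduct u w‖ ≤ 2 * ‖w‖ * ‖u‖ := by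
  have key : ∀ b c, ‖u b * w c - u c * w b‖ ≤ 2 * ‖w‖ * ‖u‖ := fun b c => by
    have h1 : ‖u b * w c‖ ≤ ‖u‖ * ‖w‖ := by
      rw [norm_mul]
      exact mul_le_mul (norm_le_pi_norm u b) (norm_le_pi_norm w c) (norm_nonneg _) (norm_nonneg _)
    have h2 : ‖u c * w b‖ ≤ ‖u‖ * ‖w‖ := by
      rw [norm_mul]
      exact mul_le_mul (norm_le_pi_norm u c) (norm_le_pi_norm w b) (norm_nonneg _) (norm_nonneg _)
    linarith [norm_sub_le (u b * w c) (u c * w b)]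
  refine (pi_norm_le_iff_of_nonneg (by positivity)).2 fun b => ?_
  fin_cases b
  · simpa [cross_apply] using key 1 2
  · simpa [cross_apply] using key 2 0
  · simpa [cross_apply] using key 0 1

lemma sum_erase_inl {ι κ M : Type*} [Fintype ι] [Fintype κ] [DecidableEq ι] [DecidableEq κ]
    [AddCommGroup M] (f : ι ⊕ κ → M) (hf : ∀ k, f (Sum.inr k) = 0) (j : ι) :
    ∑ l ∈ Finset.univ.erase (Sum.inl j), f l = ∑ k ∈ Finset.univ.erase j, f (Sum.inl k) := by
  rw [Finset.sum_erase_eq_sub (Finset.mem_univ _), Finset.sum_erase_eq_sub (Finset.mem_univ _),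
    Fintype.sum_sum_type]
  simp [hf]

/-! ### Extension of the soliton equations to complex arguments. -/

section Soliton

open Matrix

/-- The sphere constraint and the half-wave maps equation of a rational soliton, extended to
complex arguments off the poles. The poles and their conjugates form one family `a`, of sign `ε`. -/
lemma IsRationalSoliton.complex_equations {N : ℕ} {T : Set ℝ} {m : ℝ → ℝ → Fin 3 → ℝ}
    {m₀ : Fin 3 → ℝ} {s : Fin N → ℝ → Fin 3 → ℂ} {x : Fin N → ℝ → ℂ}
    (hT : UniqueDiffOn ℝ T) (hm : IsHalfWaveMap T m) (hsol : IsRationalSoliton T m m₀ s x) :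
    ∃ (a v : Fin N ⊕ Fin N → ℝ → ℂ) (d d' : Fin N ⊕ Fin N → ℝ → Fin 3 → ℂ)
      (ε : Fin N ⊕ Fin N → ℂ), (∀ j, a (Sum.inl j) = x j) ∧ (∀ j, d (Sum.inl j) = s j) ∧
      (∀ j, ε (Sum.inl j) = 1) ∧ (∀ j, ε (Sum.inr j) = -1) ∧
      (∀ t ∈ T, Function.Injective fun l => a l t) ∧
      (∀ l, ∀ t ∈ T, HasDerivWithinAt (a l) (v l t) T t) ∧
      (∀ l, ∀ t ∈ T, HasDerivWithinAt (d l) (d' l t) T t) ∧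
      (∀ t ∈ T, ∀ z, (∀ l, z ≠ a l t) →
        ∑ b, (m₀ b + Complex.I * ∑ l, ε l * d l t b / (z - a l t)) ^ 2 = 1) ∧
      (∀ t ∈ T, ∀ z, (∀ l, z ≠ a l t) →
        (fun b => Complex.I * ∑ l,
          (ε l * d' l t b / (z - a l t) + ε l * d l t b * v l t / (z - a l t) ^ 2)) =
        crossProduct (fun b => m₀ b + Complex.I * ∑ l, ε l * d l t b / (z - a l t))
          (fun b => ∑ l, d l t b / (z - a l t) ^ 2)) := by
  let a : Fin N ⊕ Fin N → ℝ → ℂ := Sum.elim x fun k t => (starRingEnd ℂ) (x k t)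
  let d : Fin N ⊕ Fin N → ℝ → Fin 3 → ℂ := Sum.elim s fun k t b => (starRingEnd ℂ) (s k t b)
  let ε : Fin N ⊕ Fin N → ℝ := Sum.elim (fun _ => 1) fun _ => -1
  have hε : ∀ l, ε l ^ 2 = 1 := by rintro (k | k) <;> simp [ε]
  have ha : ∀ t ∈ T, ∀ l, 0 < ε l * (a l t).im := by
    rintro t ht (k | k) <;> simpa [ε, a] using hsol.upper k t ht
  have him : ∀ t ∈ T, ∀ l, (a l t).im ≠ 0 := fun t ht l h => by
    have := ha t ht l
    simp [h] at this
  have nz : ∀ t ∈ T, ∀ l (y : ℝ), (y : ℂ) - a l t ≠ 0 := fun t ht l y h => him t ht l (by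
    have := congrArg Complex.im h
    simpa using this)
  have hinj : ∀ t ∈ T, Function.Injective fun l => a l t := by
    have hx : ∀ t ∈ T, Function.Injective fun k => x k t := fun t ht j k h => by
      by_contra hjk
      exact hsol.distinct t ht j k hjk h
    rintro t ht (j | j) (k | k) h
    · exact congrArg _ (hx t ht h)
    · have h1 := hsol.upper j t ht
      have h2 := hsol.upper k t ht
      have := congrArg Complex.im h
      simp [a] at this
      linarith
    · have h1 := hsol.upper j t ht
      have h2 := hsol.upper k t ht
      have := congrArg Complex.im h
      simp [a] at this
      linarith
    · exact congrArg _ (hx t ht ((starRingEnd ℂ).injective h))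
  have hform : ∀ t ∈ T, ∀ (y : ℝ) b,
      (m y t b : ℂ) = m₀ b + Complex.I * ∑ l, ε l * d l t b / ((y : ℂ) - a l t) := by
    intro t ht y b
    rw [hsol.form y t ht b, Fintype.sum_sum_type]
    simp [a, d, ε, neg_div, ← sub_eq_add_neg, add_sub_assoc, mul_sub]
  have hv : ∀ l, ∀ t ∈ T, HasDerivWithinAt (a l) (derivWithin (a l) T t) T t := by
    rintro (k | k) t ht
    · exact (hsol.pole_differentiable k t ht).hasDerivWithinAt
    · exact (Complex.conjCLE.differentiable.comp_differentiableOn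
        (hsol.pole_differentiable k) t ht).hasDerivWithinAt
  have hd : ∀ l, ∀ t ∈ T, HasDerivWithinAt (d l) (derivWithin (d l) T t) T t := by
    rintro (k | k) t ht
    · exact (hsol.spin_differentiable k t ht).hasDerivWithinAt
    · refine DifferentiableWithinAt.hasDerivWithinAt ?_
      rw [differentiableWithinAt_pi]
      intro b
      exact Complex.conjCLE.differentiable.differentiableAt.comp_differentiableWithinAt t
        (differentiableWithinAt_pi.1 (hsol.spin_differentiable k t ht) b)
  have hext : ∀ t ∈ T, ∀ F : ℂ → ℂ, (∀ z, (∀ l, z ≠ a l t) → DifferentiableAt ℂ F z) →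
      (∀ y : ℝ, F y = 0) → ∀ z, (∀ l, z ≠ a l t) → F z = 0 := by
    intro t ht F hF h0 z hz
    refine eq_zero_of_eq_zero_on_real (Set.finite_range fun l => a l t) ?_ (fun w hw => ?_) h0
      (by rintro ⟨l, h⟩; exact hz l h.symm)
    · rintro _ ⟨l, rfl⟩
      exact him t ht l
    · exact (hF w fun l h => hw ⟨l, h.symm⟩).differentiableWithinAt
  have hdiff : ∀ t, ∀ z, (∀ l, z ≠ a l t) → ∀ (c : Fin N ⊕ Fin N → ℂ) (p : ℕ),
      DifferentiableAt ℂ (fun z => ∑ l, c l / (z - a l t) ^ p) z := by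
    intro t z hz c p
    exact DifferentiableAt.fun_sum fun l _ => DifferentiableAt.div (by fun_prop) (by fun_prop)
      (pow_ne_zero _ (sub_ne_zero.2 (hz l)))
  have hdM : ∀ t, ∀ z, (∀ l, z ≠ a l t) → ∀ b, DifferentiableAt ℂ
      (fun z => (m₀ b : ℂ) + Complex.I * ∑ l, ε l * d l t b / (z - a l t)) z := by
    intro t z hz b
    have := ((hdiff t z hz (fun l => ε l * d l t b) 1).const_mul Complex.I).const_add (m₀ b : ℂ)
    simpa using this
  refine ⟨a, fun l => derivWithin (a l) T, d, fun l => derivWithin (d l) T, fun l => ε l,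
    fun _ => rfl, fun _ => rfl, fun _ => by simp [ε], fun _ => by simp [ε], hinj, hv, hd, ?_, ?_⟩
  · intro t ht z hz
    have := hext t ht (fun z => ∑ b, ((m₀ b : ℂ) + Complex.I * ∑ l,
      ε l * d l t b / (z - a l t)) ^ 2 - 1)
      (fun w hw => (DifferentiableAt.fun_sum fun b _ => (hdM t w hw b).pow 2).sub_const 1)
      (fun y => by
        simp only [← hform t ht]
        have := hm.sphere y t ht
        simp only [dotProduct, ← pow_two] at this
        rw [sub_eq_zero]
        exact_mod_cast this) z hz
    exact sub_eq_zero.1 this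
  · intro t ht
    -- On the real line, differentiating the pole expansion in time must give the derivative
    -- prescribed by the equation, and the half-Laplacian is the explicit sum of double poles.
    have hreal : ∀ (y : ℝ) b,
        Complex.I * ∑ l, (ε l * derivWithin (d l) T t b / ((y : ℂ) - a l t)
          + ε l * d l t b * derivWithin (a l) T t / ((y : ℂ) - a l t) ^ 2) =
        crossProduct (fun b => (m y t b : ℂ))
          (fun b => ∑ l, d l t b / ((y : ℂ) - a l t) ^ 2) b := by
      intro y b
      have h1 := (hasDerivWithinAt_pi.1 (hm.equation y t ht) b).ofReal_comp
      have h2 : HasDerivWithinAt (fun τ => (m₀ b : ℂ) + Complex.I * ∑ l,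
          ε l * d l τ b / ((y : ℂ) - a l τ))
          (Complex.I * ∑ l, (ε l * derivWithin (d l) T t b / ((y : ℂ) - a l t)
          + ε l * d l t b * derivWithin (a l) T t / ((y : ℂ) - a l t) ^ 2)) T t := by
        refine ((HasDerivWithinAt.fun_sum fun l _ => ?_).const_mul Complex.I).const_add _
        refine (((hasDerivWithinAt_pi.1 (hd l t ht) b).const_mul (ε l : ℂ)).fun_div
          ((hv l t ht).const_sub (y : ℂ)) (nz t ht l y)).congr_deriv ?_
        have := nz t ht l y
        field_simp
        ring
      have h3 := (hT t ht).eq_deriv _ (h2.congr (fun τ hτ => hform τ hτ y b) (hform t ht y b)) h1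
      have h4 : (fun b => ∑ l, d l t b / ((y : ℂ) - a l t) ^ 2) =
          fun b => (halfLaplacian (fun z => m z t) y b : ℂ) := funext fun b =>
        (halfLaplacian_of_simple_poles hε (ha t ht) (hform t ht) y (hm.integrable y t ht) b).symm
      rw [h3, h4]
      fin_cases b <;> simp [cross_apply]
    have key : ∀ (b b₁ b₂ : Fin 3), (∀ u w : Fin 3 → ℂ, crossProduct u w b
        = u b₁ * w b₂ - u b₂ * w b₁) → ∀ z, (∀ l, z ≠ a l t) →
        Complex.I * ∑ l, (ε l * derivWithin (d l) T t b / (z - a l t)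
          + ε l * d l t b * derivWithin (a l) T t / (z - a l t) ^ 2) =
        crossProduct (fun b => (m₀ b : ℂ) + Complex.I * ∑ l, ε l * d l t b / (z - a l t))
          (fun b => ∑ l, d l t b / (z - a l t) ^ 2) b := by
      intro b b₁ b₂ hb z hz
      have := hext t ht (fun z => Complex.I * ∑ l, (ε l * derivWithin (d l) T t b / (z - a l t)
          + ε l * d l t b * derivWithin (a l) T t / (z - a l t) ^ 2) -
        crossProduct (fun b => (m₀ b : ℂ) + Complex.I * ∑ l, ε l * d l t b / (z - a l t))
          (fun b => ∑ l, d l t b / (z - a l t) ^ 2) b) (fun w hw => by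
          simp only [hb, Finset.sum_add_distrib]
          have e1 := hdiff t w hw (fun l => ε l * derivWithin (d l) T t b) 1
          simp only [pow_one] at e1
          exact ((e1.add (hdiff t w hw _ 2)).const_mul _).sub
            (((hdM t w hw _).mul (hdiff t w hw _ 2)).sub ((hdM t w hw _).mul (hdiff t w hw _ 2))))
        (fun y => by
          simp only [← hform t ht]
          exact sub_eq_zero.2 (hreal y b)) z hz
      exact sub_eq_zero.1 this
    intro z hz
    funext b
    fin_cases b
    · exact key 0 1 2 (fun u w => by simp [cross_apply]) z hz
    · exact key 1 2 0 (fun u w => by simp [cross_apply]) z hz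
    · exact key 2 0 1 (fun u w => by simp [cross_apply]) z hz

end Soliton

/-! ### A priori bounds for spins and poles. -/

section Soliton

open Matrix

variable {N : ℕ} {T : Set ℝ} {m : ℝ → ℝ → Fin 3 → ℝ}
    {m₀ : Fin 3 → ℝ} {s : Fin N → ℝ → Fin 3 → ℂ} {x : Fin N → ℝ → ℂ}

/-- The spins of a rational soliton satisfy `s_j' = 2 ∑_{k ≠ j} s_j × s_k / (x_j - x_k)²`. -/
lemma IsRationalSoliton.hasDerivWithinAt_spin (hT : UniqueDiffOn ℝ T) (hm : IsHalfWaveMap T m)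
    (hsol : IsRationalSoliton T m m₀ s x) (j : Fin N) {t : ℝ} (ht : t ∈ T) :
    HasDerivWithinAt (s j) (crossProduct (s j t)
      (∑ k ∈ Finset.univ.erase j, (2 / (x j t - x k t) ^ 2) • s k t)) T t := by
  obtain ⟨a, v, d, d', ε, ha, hd, hε, hε', hinj, hav, hdd, HM, HE⟩ := hsol.complex_equations hT hm
  have := spin_equation (hinj t ht) (HM t ht) (HE t ht) (hε j)
  rw [sum_erase_inl _ (fun k => by simp [hε'])] at this
  have h := hdd (Sum.inl j) t ht
  rw [this] at h
  simpa [ha, hd, hε, one_add_one_eq_two] using h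

/-- The poles of a rational soliton satisfy `x_j'' = 4 ∑_{k ≠ j} s_j ⬝ s_k / (x_j - x_k)³`. -/
lemma IsRationalSoliton.exists_velocity (hT : UniqueDiffOn ℝ T) (hm : IsHalfWaveMap T m)
    (hsol : IsRationalSoliton T m m₀ s x) (hs : ∀ j, ∀ t ∈ T, s j t ≠ 0) :
    ∃ v : Fin N → ℝ → ℂ, (∀ j, ∀ t ∈ T, HasDerivWithinAt (x j) (v j t) T t) ∧
      ∀ j, ∀ t ∈ T, HasDerivWithinAt (v j)
        (4 * ∑ k ∈ Finset.univ.erase j, (s j t ⬝ᵥ s k t) / (x j t - x k t) ^ 3) T t := by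
  obtain ⟨a, v, d, d', ε, ha, hd, hε, hε', hinj, hav, hdd, HM, HE⟩ := hsol.complex_equations hT hm
  refine ⟨fun j => v (Sum.inl j), fun j t ht => ha j ▸ hav (Sum.inl j) t ht, fun j t ht => ?_⟩
  have h := hasDerivWithinAt_velocity hT hinj hav hdd HM HE (hε j)
    (fun t ht => by rw [hd]; exact hs j t ht) ht
  rw [sum_erase_inl _ (fun k => by simp [hε'])] at h
  refine h.congr_deriv ?_
  simp only [ha, hd, hε, Finset.mul_sum]
  exact Finset.sum_congr rfl fun k _ => by ring

/-- The imaginary parts of the poles grow at most linearly, because the centre of mass of the poles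
moves at constant velocity. -/
lemma IsRationalSoliton.exists_im_le (hT : UniqueDiffOn ℝ T) (hconv : Convex ℝ T)
    (h0 : (0 : ℝ) ∈ T) (hm : IsHalfWaveMap T m)
    (hsol : IsRationalSoliton T m m₀ s x) (hs : ∀ j, ∀ t ∈ T, s j t ≠ 0) :
    ∃ A B : ℝ, 0 ≤ B ∧ ∀ j, ∀ t ∈ T, (x j t).im ≤ A + B * |t| := by
  obtain ⟨v, hv, hv'⟩ := hsol.exists_velocity hT hm hs
  have hsum : ∀ t ∈ T, HasDerivWithinAt (fun τ => ∑ j, v j τ) 0 T t := by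
    intro t ht
    refine (HasDerivWithinAt.fun_sum (u := Finset.univ) fun j _ => hv' j t ht).congr_deriv ?_
    rw [← Finset.mul_sum, mul_eq_zero]
    right
    -- The diagonal term may be restored because division by zero gives zero.
    have e : ∀ j, ∑ k ∈ Finset.univ.erase j, (s j t ⬝ᵥ s k t) / (x j t - x k t) ^ 3 =
        ∑ k, (s j t ⬝ᵥ s k t) / (x j t - x k t) ^ 3 := fun j =>
      Finset.sum_erase _ (by simp)
    simp only [e]
    -- Exchanging `j` and `k` flips the sign of the cubed difference: action equals reaction.
    have anti : ∑ j, ∑ k, (s j t ⬝ᵥ s k t) / (x j t - x k t) ^ 3 =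
        -∑ j, ∑ k, (s j t ⬝ᵥ s k t) / (x j t - x k t) ^ 3 := by
      conv_lhs => rw [Finset.sum_comm]
      rw [← Finset.sum_neg_distrib]
      refine Finset.sum_congr rfl fun j _ => ?_
      rw [← Finset.sum_neg_distrib]
      refine Finset.sum_congr rfl fun k _ => ?_
      rw [dotProduct_comm, ← div_neg]
      congr 1
      ring
    exact self_eq_neg.1 anti
  have hconst : ∀ t ∈ T, ∑ j, v j t = ∑ j, v j 0 := fun t ht => by
    have := hconv.norm_image_sub_le_of_norm_hasDerivWithin_le (C := 0) hsum (by simp) h0 ht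
    simpa [sub_eq_zero] using this
  have hX : ∀ t ∈ T, ‖∑ j, x j t - ∑ j, x j 0‖ ≤ ‖∑ j, v j 0‖ * |t| := fun t ht => by
    have := hconv.norm_image_sub_le_of_norm_hasDerivWithin_le (C := ‖∑ j, v j 0‖)
      (fun t ht => HasDerivWithinAt.fun_sum (u := Finset.univ) fun j _ => hv j t ht)
      (fun t ht => by rw [hconst t ht]) h0 ht
    simpa using this
  refine ⟨‖∑ j, x j 0‖, ‖∑ j, v j 0‖, norm_nonneg _, fun j t ht => ?_⟩
  calc (x j t).im ≤ ∑ j, (x j t).im :=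
        Finset.single_le_sum (f := fun j => (x j t).im) (fun k _ => (hsol.upper k t ht).le)
          (Finset.mem_univ j)
    _ = (∑ j, x j t).im := by simp
    _ ≤ ‖∑ j, x j t‖ := (le_abs_self _).trans (Complex.abs_im_le_norm _)
    _ ≤ ‖∑ j, x j 0‖ + ‖∑ j, x j t - ∑ j, x j 0‖ := norm_le_norm_add_norm_sub' _ _
    _ ≤ _ := by linarith [hX t ht]

/-- The spins never vanish. -/
lemma IsRationalSoliton.spin_ne_zero (hT : UniqueDiffOn ℝ T) (hord : T.OrdConnected)
    (h0 : (0 : ℝ) ∈ T) (hm : IsHalfWaveMap T m)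
    (hsol : IsRationalSoliton T m m₀ s x) (j : Fin N) {t : ℝ} (ht : t ∈ T) : s j t ≠ 0 := by
  intro h
  have hsub : Set.uIcc t 0 ⊆ T := hord.uIcc_subset ht h0
  -- On the compact interval from `t` to `0` the poles stay distinct, so the coefficient is bounded
  -- there; a zero at time `t` would propagate back to time `0`.
  have hcont : ContinuousOn (fun t => ∑ k ∈ Finset.univ.erase j, (2 / (x j t - x k t) ^ 2) • s k t)
      (Set.uIcc t 0) := by
    refine continuousOn_finsetSum _ fun k hk => ?_
    refine ContinuousOn.smul (continuousOn_const.div (((hsol.pole_differentiable j).continuousOn.sub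
      (hsol.pole_differentiable k).continuousOn).pow 2 |>.mono hsub) fun τ hτ => ?_)
      ((hsol.spin_differentiable k).continuousOn.mono hsub)
    exact pow_ne_zero _ (sub_ne_zero.2
      (hsol.distinct τ (hsub hτ) j k (Finset.ne_of_mem_erase hk).symm))
  obtain ⟨K, hK⟩ := isCompact_uIcc.exists_bound_of_continuousOn hcont
  have := norm_le_norm_mul_exp hsub (fun τ hτ => hsol.hasDerivWithinAt_spin hT hm j hτ)
    (K := 2 * K) (fun τ hτ => (norm_crossProduct_le _ _).trans
      (mul_le_mul_of_nonneg_right (by linarith [hK τ hτ]) (norm_nonneg _)))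
  rw [h, norm_zero, zero_mul] at this
  exact hsol.spin_initial j (norm_le_zero_iff.1 this)

/-- A spin is bounded by the imaginary part of its pole, when the poles are separated. -/
lemma IsRationalSoliton.norm_spin_le (hm : IsHalfWaveMap T m)
    (hsol : IsRationalSoliton T m m₀ s x) {t c A : ℝ} (ht : t ∈ T) (hc : 0 < c)
    (hsep : ∀ j k, j ≠ k → c ≤ ‖x j t - x k t‖) (hA : ∀ j, (x j t).im ≤ A) (j : Fin N) :
    ‖s j t‖ ≤ 2 * (1 + 2 * A / c) ^ N * (x j t).im := by
  have hj := hsol.upper j t ht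
  have hA0 : 0 ≤ A := hj.le.trans (hA j)
  refine (pi_norm_le_iff_of_nonneg (by positivity)).2 fun b => ?_
  have hinj : Function.Injective fun k => x k t := fun j k h => by
    by_contra hjk
    exact hsol.distinct t ht j k hjk h
  have hbound : ∀ y : ℝ, ‖(m₀ b : ℂ) + Complex.I * ∑ k, s k t b / ((y : ℂ) - x k t)
      - Complex.I * ∑ k, (starRingEnd ℂ) (s k t b) / ((y : ℂ) - (starRingEnd ℂ) (x k t))‖ ≤ 1 := by
    intro y
    rw [← hsol.form y t ht b, Complex.norm_real, Real.norm_eq_abs, ← sq_le_one_iff_abs_le_one,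
      ← hm.sphere y t ht, pow_two]
    exact Finset.single_le_sum (f := fun b => m y t b * m y t b) (fun b _ => mul_self_nonneg _)
      (Finset.mem_univ b)
  refine (norm_residue_le (fun k => hsol.upper k t ht) hinj hbound j).trans ?_
  have hone : 1 ≤ 1 + 2 * A / c := le_add_of_nonneg_right (by positivity)
  -- The conjugate of `x k` lies within `2 A` of `x k`, and `2 A ≤ (2 A / c) ‖x j - x k‖` by
  -- separation.
  have hprod : ∏ k ∈ Finset.univ.erase j, (‖x j t - (starRingEnd ℂ) (x k t)‖ / ‖x j t - x k t‖)
      ≤ (1 + 2 * A / c) ^ N := by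
    calc _ ≤ ∏ k ∈ Finset.univ.erase j, (1 + 2 * A / c) := by
          refine Finset.prod_le_prod (fun k _ => by positivity) fun k hk => ?_
          have hjk := hsep j k (Finset.ne_of_mem_erase hk).symm
          have hpos : 0 < ‖x j t - x k t‖ := hc.trans_le hjk
          have h1 : ‖x k t - (starRingEnd ℂ) (x k t)‖ ≤ 2 * A := by
            rw [Complex.sub_conj]
            simp [abs_of_pos (hsol.upper k t ht), hA k]
          rw [div_le_iff₀ hpos]
          calc ‖x j t - (starRingEnd ℂ) (x k t)‖
              ≤ ‖x j t - x k t‖ + ‖x k t - (starRingEnd ℂ) (x k t)‖ :=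
                norm_sub_le_norm_sub_add_norm_sub _ _ _
            _ ≤ ‖x j t - x k t‖ + 2 * A / c * ‖x j t - x k t‖ := by
                refine add_le_add le_rfl (h1.trans ?_)
                rw [div_mul_eq_mul_div, le_div_iff₀ hc]
                exact mul_le_mul_of_nonneg_left hjk (by positivity)
            _ = _ := by ring
      _ = (1 + 2 * A / c) ^ (Finset.univ.erase j).card := by rw [Finset.prod_const]
      _ ≤ _ := pow_le_pow_right₀ hone (by simp)
  nlinarith [mul_le_mul_of_nonneg_left hprod hj.le]

end Soliton

/-! ### Exclusion of blow-up. -/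

theorem mainTheorem3 {N : ℕ} (T : Set ℝ) (hT : T.OrdConnected) (h0 : (0 : ℝ) ∈ T)
    (m : ℝ → ℝ → Fin 3 → ℝ) (m₀ : Fin 3 → ℝ)
    (s : Fin N → ℝ → Fin 3 → ℂ) (x : Fin N → ℝ → ℂ)
    (hm : IsHalfWaveMap T m) (hsol : IsRationalSoliton T m m₀ s x)
    (t₀ : ℝ)
    (hsep : ∃ c > 0, ∀ᶠ t in 𝓝[T] t₀, ∀ j k, j ≠ k → c ≤ ‖x j t - x k t‖) :
    ¬ ∃ (i : Fin N) (u : ℕ → ℝ), (∀ n, u n ∈ T) ∧ Tendsto u atTop (𝓝 t₀) ∧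
      Tendsto (fun n => (x i (u n)).im) atTop (𝓝 0) := by
  rintro ⟨i, u, huT, hu, hlim⟩
  -- If `T = {0}`, derivatives within `T` carry no information, but the sequence is constant and its
  -- pole stays in the open half-plane.
  rcases T.subsingleton_or_nontrivial with hsub | hnt
  · have : Tendsto (fun n => (x i (u n)).im) atTop (𝓝 (x i 0).im) := by
      simp only [hsub (huT _) h0]
      exact tendsto_const_nhds
    exact (hsol.upper i 0 h0).ne' (tendsto_nhds_unique this hlim)
  have hconv : Convex ℝ T := hT.convex
  have hud : UniqueDiffOn ℝ T := by
    obtain ⟨p, hp, q, hq, hpq⟩ := hnt.exists_lt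
    refine uniqueDiffOn_convex hconv ⟨(p + q) / 2, ?_⟩
    rw [mem_interior_iff_mem_nhds]
    exact mem_of_superset (Icc_mem_nhds (by linarith) (by linarith)) (hT.out hp hq)
  have hs : ∀ j, ∀ t ∈ T, s j t ≠ 0 := fun j t ht => hsol.spin_ne_zero hud hT h0 hm j ht
  obtain ⟨c, hc, hsep⟩ := hsep
  obtain ⟨δ, hδ, hball⟩ := Metric.mem_nhdsWithin_iff.1 hsep
  obtain ⟨A', B, hB, hAB⟩ := hsol.exists_im_le hud hconv h0 hm hs
  let A := A' + B * (|t₀| + δ)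
  have hA : ∀ j, ∀ t ∈ T, t ∈ Metric.ball t₀ δ → (x j t).im ≤ A := fun j t ht htb => by
    refine (hAB j t ht).trans (add_le_add le_rfl (mul_le_mul_of_nonneg_left ?_ hB))
    rw [Metric.mem_ball, Real.dist_eq] at htb
    linarith [abs_sub_abs_le_abs_sub t t₀]
  have hspin : ∀ t ∈ T, t ∈ Metric.ball t₀ δ → ∀ j,
      ‖s j t‖ ≤ 2 * (1 + 2 * A / c) ^ N * (x j t).im := fun t ht htb j =>
    hsol.norm_spin_le hm ht hc (hball ⟨htb, ht⟩) (fun j => hA j t ht htb) j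
  have hev : ∀ᶠ n in atTop, u n ∈ Metric.ball t₀ δ := hu.eventually (Metric.ball_mem_nhds t₀ hδ)
  obtain ⟨n₀, hn₀⟩ := hev.exists
  have hA0 : 0 ≤ A := (hsol.upper i _ (huT n₀)).le.trans (hA i _ (huT n₀) hn₀)
  let P := 2 * (1 + 2 * A / c) ^ N
  have hP : 0 ≤ P := by positivity
  -- Bounds at most `N` terms: `2 / c²` comes from the separation and `P * A` from the spin bound.
  let K := N * (2 / c ^ 2 * (P * A))
  have hK : ∀ t ∈ T, t ∈ Metric.ball t₀ δ →
      ‖∑ k ∈ Finset.univ.erase i, (2 / (x i t - x k t) ^ 2) • s k t‖ ≤ K := by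
    intro t ht htb
    have hterm : ∀ k ∈ Finset.univ.erase i, ‖(2 / (x i t - x k t) ^ 2) • s k t‖
        ≤ 2 / c ^ 2 * (P * A) := fun k hk => by
      have hik := hball ⟨htb, ht⟩ i k (Finset.ne_of_mem_erase hk).symm
      rw [norm_smul, norm_div, norm_pow, Complex.norm_ofNat]
      refine mul_le_mul ?_ ((hspin t ht htb k).trans
        (mul_le_mul_of_nonneg_left (hA k t ht htb) hP)) (norm_nonneg _) (by positivity)
      exact div_le_div_of_nonneg_left (by norm_num) (by positivity)
        (pow_le_pow_left₀ hc.le hik 2)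
    refine (norm_sum_le_of_le _ hterm).trans ?_
    rw [Finset.sum_const, nsmul_eq_mul]
    refine mul_le_mul_of_nonneg_right ?_ (by positivity)
    have : (Finset.univ.erase i).card ≤ N := by simp
    exact_mod_cast this
  have hK0 : 0 ≤ K := by positivity
  -- Grönwall runs from `u n` to the fixed time `u n₀`, inside an interval of length at most `2 δ`;
  -- the spin at `u n` is in turn controlled by the collapsing imaginary part.
  have hle : ∀ᶠ n in atTop,
      ‖s i (u n₀)‖ ≤ P * (x i (u n)).im * Real.exp (2 * K * (2 * δ)) := by
    filter_upwards [hev] with n hn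
    have hsub : Set.uIcc (u n) (u n₀) ⊆ T := hT.uIcc_subset (huT n) (huT n₀)
    have hsubb : Set.uIcc (u n) (u n₀) ⊆ Metric.ball t₀ δ := by
      rw [Real.ball_eq_Ioo] at hn hn₀ ⊢
      exact Set.ordConnected_Ioo.uIcc_subset hn hn₀
    have h1 := norm_le_norm_mul_exp hsub (fun τ hτ => hsol.hasDerivWithinAt_spin hud hm i hτ)
      (K := 2 * K) (fun τ hτ => (norm_crossProduct_le _ _).trans
        (mul_le_mul_of_nonneg_right (by linarith [hK τ (hsub hτ) (hsubb hτ)]) (norm_nonneg _)))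
    have h2 : |u n₀ - u n| ≤ 2 * δ := by
      rw [Metric.mem_ball] at hn hn₀
      rw [← Real.dist_eq]
      linarith [dist_triangle_right (u n₀) (u n) t₀]
    refine h1.trans (mul_le_mul (hspin _ (huT n) hn i) (Real.exp_le_exp.2
      (mul_le_mul_of_nonneg_left h2 (by positivity))) (Real.exp_pos _).le ?_)
    exact mul_nonneg hP (hsol.upper i _ (huT n)).le
  have hzero : Tendsto (fun n => P * (x i (u n)).im * Real.exp (2 * K * (2 * δ))) atTop (𝓝 0) := by
    simpa using (hlim.const_mul P).mul_const (Real.exp (2 * K * (2 * δ)))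
  exact hs i _ (huT n₀) (norm_le_zero_iff.1 (ge_of_tendsto hzero hle))
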